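/- Let $L$ be a countable (possibly many-sorted) first-order language and let $T$ be a complete $L$-theory. Let $\mathfrak C\models T$ be a monster model: it is $\kappa$-saturated and strongly $\kappa$-homogeneous for some cardinal $\kappa>2^{\aleph_0}$. "Small" and "bounded" mean of cardinality less than $\kappa$; "invariant" means invariant under $\mathrm{Aut}(\mathfrak C)$; "type-definable" means type-definable without parameters. Let $P$ be a product of countably many sorts of $\mathfrak C$, let $X\subseteq P$ be type-definable, and let $E$ be an invariant equivalence relation on $X$ such that: - $E$ is bounded: it has fewer than $\kappa$ classes; - $E$ is $F_\sigma$: the set $\{\mathrm{tp}(a,b/\emptyset) : a\mathrel{E}b\}$ is a countable union of closed subsets of the space $S_{P^2}(\emptyset)$ of complete types over $\emptyset$; - $E$ is orbital on types: $a\mathrel{E}b$ implies $\mathrm{tp}(a/\emptyset)=\mathrm{tp}(b/\emptyset)$, and for every complete type $p$ over $\emptyset$ there is a group $\Gamma\le\mathrm{Aut}(\mathfrak C)$ which preserves setwise every class of the restriction of $E$ to the elements of $X$ realising $p$, and which acts transitively on each of these classes. A normal form of $E$ is a sequence $(\Phi_n(x,y))_{n\in\mathbb N}$ of partial types over $\emptyset$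 on $X$ (that is, each implying $x,y\in X$) such that $\Phi_0(x,y)$ is equivalent to $x=y\wedge x\in X$, each $\Phi_n$ implies $\Phi_{n+1}$, for all $a,b\in X$ we have $a\mathrel{E}b$ if and only if $\models\Phi_n(a,b)$ for some $n$, and $d(a,b)=\min\{n : {}\models\Phi_n(a,b)\}$ (with $\min\emptyset=\infty$) is a metric on $X$ with values in $\mathbb N\cup\{\infty\}$. The diameter of a nonempty subset of $X$ is the supremum of the $d$-distances between its points. Let $Y\subseteq X$ be pseudo-closed (type-definable with a small set of parameters) and $E$-saturated (a union of $E$-classes), and suppose that $Y$ contains an $E$-class which has infinite diameter with respect to some normal form of $E$. For a countable model $M\preceq\mathfrak C$, let $S_P(M)$ be the space of complete types over $M$ of elements of $P$, let $Y_M=\{\mathrm{tp}(a/M) : a\in Y\}$ with the subspace topology, and let $p\mathrel{E^M}q$ mean that there are $a\models p$ and $b\models q$ with $a\mathrel{E}b$. Then, for every countable model $M\preceq\mathfrak C$: 1. $E$ restricted to $Y$ is not smooth, that is, $E^M$ restricted to $Y_M$ is not Borel reducible to the equality relation of any Polish space; 2. there is a continuous injective map $f\colon 2^{\mathbb N}\to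 Y_M$ such that for all $x,y\in 2^{\mathbb N}$ we have $x\mathrel{E_0}y$ if and only if $f(x)\mathrel{E^M}f(y)$, where $x\mathrel{E_0}y$ means that $x(n)=y(n)$ for all sufficiently large $n$. -/

import Mathlib

universe u v

namespace ManySorted

/-! ## Many-sorted first-order logic

Mathlib only has one-sorted languages.  The definitions below are their direct many-sorted
analogue; a one-sorted language is the case in which the type of sorts has one element. -/

/-- A first-order language with sorts `S`: function symbols (constants are those of arity `0`) and
relation symbols, each with the sorts of its arguments.  Equality on each sort is logical. -/
structure Lang (S : Type) where
  Fun : Type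
  arity : Fun → ℕ
  dom : ∀ f : Fun, Fin (arity f) → S
  cod : Fun → S
  Rel : Type
  relArity : Rel → ℕ
  relDom : ∀ r : Rel, Fin (relArity r) → S

/-- Tuples of elements of `𝔐` whose `i`-th entry has sort `σ i`: the product of the sorts `σ i`. -/
abbrev Tup {S : Type} (𝔐 : S → Type u) {V : Type v} (σ : V → S) : Type (max u v) :=
  ∀ i : V, 𝔐 (σ i)

/-- Concatenation of two tuples. -/
def Tup.append {S : Type} {𝔐 : S → Type u} {V : Type v} {W : Type*} {σ : V → S} {τ : W → S}
    (a : Tup 𝔐 σ) (b : Tup 𝔐 τ) : Tup 𝔐 (Sum.elim σ τ)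
  | Sum.inl i => a i
  | Sum.inr j => b j

/-- An `L`-structure with universes `𝔐 s` for the sorts `s`. -/
class Str {S : Type} (L : Lang S) (𝔐 : S → Type u) where
  funMap : ∀ f : L.Fun, Tup 𝔐 (L.dom f) → 𝔐 (L.cod f)
  relMap : ∀ r : L.Rel, Tup 𝔐 (L.relDom r) → Prop

/-- Terms of each sort in variables `V`, the variable `x` having sort `σ x`. -/
inductive Term {S : Type} (L : Lang S) {V : Type v} (σ : V → S) : S → Type v
  | var (x : V) : Term L σ (σ x)
  | func (f : L.Fun) (ts : ∀ k, Term L σ (L.dom f k)) : Term L σ (L.cod f)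

/-- Formulas with free variables `x : V` of sort `σ x` and with `n` further variables, of sorts
`τ 0, …, τ (n - 1)`, that may be bound by outer quantifiers. -/
inductive BFormula {S : Type} (L : Lang S) {V : Type v} (σ : V → S) :
    (n : ℕ) → (Fin n → S) → Type v
  | falsum {n : ℕ} {τ : Fin n → S} : BFormula L σ n τ
  | equal {n : ℕ} {τ : Fin n → S} {s : S} (t₁ t₂ : Term L (Sum.elim σ τ) s) : BFormula L σ n τ
  | rel {n : ℕ} {τ : Fin n → S} (r : L.Rel)
      (ts : ∀ k, Term L (Sum.elim σ τ) (L.relDom r k)) : BFormula L σ n τ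
  | imp {n : ℕ} {τ : Fin n → S} (φ ψ : BFormula L σ n τ) : BFormula L σ n τ
  | all {n : ℕ} {τ : Fin n → S} (s : S)
      (φ : BFormula L σ (n + 1) (Fin.cons (α := fun _ => S) s τ)) : BFormula L σ n τ

/-- Formulas all of whose free variables are in `V`. -/
abbrev Formula {S : Type} (L : Lang S) {V : Type v} (σ : V → S) : Type v :=
  BFormula L σ 0 Fin.elim0

/-- Value of a term. -/
def Term.realize {S : Type} {L : Lang S} {𝔐 : S → Type u} [Str L 𝔐] {V : Type v} {σ : V → S}
    (a : Tup 𝔐 σ) : ∀ {s : S}, Term L σ s → 𝔐 s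
  | _, .var x => a x
  | _, .func f ts => Str.funMap f (fun k => (ts k).realize a)

/-- Extension of a tuple by a new first entry. -/
def consTup {S : Type} {𝔐 : S → Type u} {n : ℕ} {τ : Fin n → S} {s : S} (x : 𝔐 s)
    (b : Tup 𝔐 τ) : Tup 𝔐 (Fin.cons (α := fun _ => S) s τ) :=
  Fin.cons (α := fun k => 𝔐 (Fin.cons (α := fun _ => S) s τ k)) x b

/-- Satisfaction of a formula. -/
def BFormula.realize {S : Type} {L : Lang S} {𝔐 : S → Type u} [Str L 𝔐] {V : Type v}
    {σ : V → S} (a : Tup 𝔐 σ) :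
    ∀ {n : ℕ} {τ : Fin n → S}, BFormula L σ n τ → Tup 𝔐 τ → Prop
  | _, _, .falsum, _ => False
  | _, _, .equal t₁ t₂, b => t₁.realize (a.append b) = t₂.realize (a.append b)
  | _, _, .rel r ts, b => Str.relMap r (fun k => (ts k).realize (a.append b))
  | _, _, .imp φ ψ, b => φ.realize a b → ψ.realize a b
  | _, _, .all s φ, b => ∀ x : 𝔐 s, φ.realize a (consTup x b)

/-- `𝔐 ⊨ φ(a)`. -/
def Sat {S : Type} {L : Lang S} {𝔐 : S → Type u} [Str L 𝔐] {V : Type v} {σ : V → S}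
    (φ : Formula L σ) (a : Tup 𝔐 σ) : Prop :=
  BFormula.realize a φ (fun k => k.elim0)

/-! ## Parameters, definability, automorphisms, elementary substructures -/

/-- A set of parameters: a set of elements of arbitrary sorts. -/
abbrev Params {S : Type} (𝔐 : S → Type u) : Type u := Set (Σ s : S, 𝔐 s)

/-- The sorts of the elements of a parameter set. -/
def Params.sort {S : Type} {𝔐 : S → Type u} (A : Params 𝔐) : A → S := fun x => x.1.1

/-- The tuple which enumerates a parameter set by itself. -/
def Params.self {S : Type} {𝔐 : S → Type u} (A : Params 𝔐) : Tup 𝔐 A.sort := fun x => x.1.2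

/-- Formulas over `A` in the variables `σ`: the elements of `A` serve as extra variables, to be
interpreted as themselves. -/
abbrev FormulaOver {S : Type} (L : Lang S) {𝔐 : S → Type u} (A : Params 𝔐) {V : Type v}
    (σ : V → S) : Type (max u v) :=
  Formula L (Sum.elim σ A.sort)

/-- `𝔐 ⊨ φ(a)` for a formula `φ` over `A`. -/
def SatOver {S : Type} {L : Lang S} {𝔐 : S → Type u} [Str L 𝔐] {A : Params 𝔐} {V : Type v}
    {σ : V → S} (φ : FormulaOver L A σ) (a : Tup 𝔐 σ) : Prop :=
  Sat φ (a.append A.self)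

/-- `X` is type-definable over `A`: the set of realisations of a partial type over `A`. -/
def IsTypeDefinableOver {S : Type} (L : Lang S) {𝔐 : S → Type u} [Str L 𝔐] (A : Params 𝔐)
    {V : Type v} {σ : V → S} (X : Set (Tup 𝔐 σ)) : Prop :=
  ∃ Φ : Set (FormulaOver L A σ), X = {a | ∀ φ ∈ Φ, SatOver φ a}

/-- The action of families of permutations of the sorts on tuples. -/
def act {S : Type} {𝔐 : S → Type u} {V : Type v} {σ : V → S}
    (g : ∀ s, Equiv.Perm (𝔐 s)) (a : Tup 𝔐 σ) : Tup 𝔐 σ :=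
  fun i => g (σ i) (a i)

/-- The automorphism group of `𝔐`. -/
def Aut {S : Type} (L : Lang S) (𝔐 : S → Type u) [Str L 𝔐] :
    Subgroup (∀ s, Equiv.Perm (𝔐 s)) where
  carrier := {g | (∀ (f : L.Fun) (a : Tup 𝔐 (L.dom f)),
      g (L.cod f) (Str.funMap f a) = Str.funMap f (act g a)) ∧
    ∀ (r : L.Rel) (a : Tup 𝔐 (L.relDom r)), Str.relMap r (act g a) ↔ Str.relMap r a}
  one_mem' := ⟨fun _ _ => rfl, fun _ _ => Iff.rfl⟩
  mul_mem' := by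
    intro g h hg hh
    refine ⟨fun f a => ?_, fun r a => ?_⟩
    · have := hg.1 f (act h a)
      rw [← hh.1 f a] at this
      exact this
    · exact (hg.2 r (act h a)).trans (hh.2 r a)
  inv_mem' := by
    intro g hg
    have key : ∀ {V : Type} {σ : V → S} (a : Tup 𝔐 σ), act g (act g⁻¹ a) = a := by
      intro V σ a
      funext i
      exact (g (σ i)).apply_symm_apply (a i)
    refine ⟨fun f a => ?_, fun r a => ?_⟩
    · have := hg.1 f (act g⁻¹ a)
      rw [key a] at this
      rw [← this]
      exact (g (L.cod f)).symm_apply_apply _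
    · have := hg.2 r (act g⁻¹ a)
      rw [key a] at this
      exact this.symm

/-- A substructure of `𝔐`. -/
structure Substr {S : Type} (L : Lang S) (𝔐 : S → Type u) [Str L 𝔐] where
  carrier : ∀ s, Set (𝔐 s)
  closed : ∀ (f : L.Fun) (a : Tup 𝔐 (L.dom f)), (∀ k, a k ∈ carrier (L.dom f k)) →
    Str.funMap f a ∈ carrier (L.cod f)

/-- The structure induced on a substructure. -/
instance Substr.str {S : Type} {L : Lang S} {𝔐 : S → Type u} [Str L 𝔐] (M : Substr L 𝔐) :
    Str L (fun s => M.carrier s) where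
  funMap f a := ⟨Str.funMap f (fun k => (a k : 𝔐 _)), M.closed f _ fun k => (a k).2⟩
  relMap r a := Str.relMap r (fun k => (a k : 𝔐 _))

/-- `M ≼ 𝔐`. -/
def Substr.IsElementary {S : Type} {L : Lang S} {𝔐 : S → Type u} [Str L 𝔐]
    (M : Substr L 𝔐) : Prop :=
  ∀ (n : ℕ) (τ : Fin n → S) (φ : Formula L τ) (a : Tup (fun s => M.carrier s) τ),
    Sat φ a ↔ Sat φ (fun k => (a k : 𝔐 (τ k)))

/-- The elements of `M` as a parameter set. -/
def Substr.params {S : Type} {L : Lang S} {𝔐 : S → Type u} [Str L 𝔐] (M : Substr L 𝔐) :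
    Params 𝔐 :=
  {x | x.2 ∈ M.carrier x.1}

/-- `M` is a countable elementary substructure of `𝔐`. -/
def Substr.IsCountableModel {S : Type} {L : Lang S} {𝔐 : S → Type u} [Str L 𝔐]
    (M : Substr L 𝔐) : Prop :=
  M.IsElementary ∧ M.params.Countable

/-- `κ`-saturation: every finitely satisfiable set of formulas in one variable (of any sort) over
fewer than `κ` parameters is realised. -/
def IsSaturated {S : Type} (L : Lang S) (𝔐 : S → Type u) [Str L 𝔐] (κ : Cardinal.{u}) : Prop :=
  ∀ A : Params 𝔐, Cardinal.mk A < κ → ∀ (s : S) (Φ : Set (FormulaOver L A (fun _ : Unit => s))),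
    (∀ Φ₀ : Finset (FormulaOver L A (fun _ : Unit => s)), ↑Φ₀ ⊆ Φ →
      ∃ x : 𝔐 s, ∀ φ ∈ Φ₀, SatOver φ (fun _ => x)) →
    ∃ x : 𝔐 s, ∀ φ ∈ Φ, SatOver φ (fun _ => x)

/-- Strong `κ`-homogeneity: every elementary map between subsets of `𝔐` of size less than `κ`
extends to an automorphism of `𝔐`. -/
def IsStronglyHomogeneous {S : Type} (L : Lang S) (𝔐 : S → Type u) [Str L 𝔐]
    (κ : Cardinal.{u}) : Prop :=
  ∀ A : Params 𝔐, Cardinal.mk A < κ → ∀ b : Tup 𝔐 A.sort,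
    (∀ φ : Formula L A.sort, Sat φ A.self ↔ Sat φ b) →
    ∃ g ∈ Aut L 𝔐, act g A.self = b

/-- A monster model (of its complete theory) with respect to `κ`; "small" and "bounded" mean
"of size less than `κ`". -/
structure IsMonster {S : Type} (L : Lang S) (𝔐 : S → Type u) [Str L 𝔐]
    (κ : Cardinal.{u}) : Prop where
  saturated : IsSaturated L 𝔐 κ
  homogeneous : IsStronglyHomogeneous L 𝔐 κ

/-- A pseudo-closed set: type-definable over a small set of parameters. -/
def IsPseudoClosed {S : Type} (L : Lang S) {𝔐 : S → Type u} [Str L 𝔐] (κ : Cardinal.{u})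
    {V : Type v} {σ : V → S} (X : Set (Tup 𝔐 σ)) : Prop :=
  ∃ A : Params 𝔐, Cardinal.mk A < κ ∧ IsTypeDefinableOver L A X

/-! ## Type spaces -/

/-- `tp(a/A)`, as a set of formulas over `A`. -/
def tp {S : Type} (L : Lang S) {𝔐 : S → Type u} [Str L 𝔐] (A : Params 𝔐) {V : Type v}
    {σ : V → S} (a : Tup 𝔐 σ) : Set (FormulaOver L A σ) :=
  {φ | SatOver φ a}

/-- The space `S_P(A)` of complete types over `A` of elements of the product of sorts `P` given
by `σ`. -/
def TypeSpace {S : Type} (L : Lang S) {𝔐 : S → Type u} [Str L 𝔐] (A : Params 𝔐) {V : Type v}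
    (σ : V → S) : Type (max u v) :=
  {p : Set (FormulaOver L A σ) // ∃ a : Tup 𝔐 σ, tp L A a = p}

/-- `tp(a/A)` as a point of the type space. -/
def TypeSpace.of {S : Type} (L : Lang S) {𝔐 : S → Type u} [Str L 𝔐] (A : Params 𝔐) {V : Type v}
    {σ : V → S} (a : Tup 𝔐 σ) : TypeSpace L A σ :=
  ⟨tp L A a, a, rfl⟩

/-- The usual topology, with the sets `[φ] = {p | φ ∈ p}` as a basis. -/
instance TypeSpace.topology {S : Type} (L : Lang S) {𝔐 : S → Type u} [Str L 𝔐]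
    (A : Params 𝔐) {V : Type v} (σ : V → S) : TopologicalSpace (TypeSpace L A σ) :=
  TopologicalSpace.generateFrom
    (Set.range fun φ : FormulaOver L A σ => {p : TypeSpace L A σ | φ ∈ p.1})

/-- `X_A = S_X(A)`, the set of types over `A` of elements of `X`. -/
def typesOf {S : Type} (L : Lang S) {𝔐 : S → Type u} [Str L 𝔐] (A : Params 𝔐) {V : Type v}
    {σ : V → S} (X : Set (Tup 𝔐 σ)) : Set (TypeSpace L A σ) :=
  TypeSpace.of L A '' X

/-! ## Invariant equivalence relations -/

/-- `E`, viewed as a set of pairs, is an equivalence relation on the set `X`. -/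
structure IsEquivOn {P : Type u} (E : P → P → Prop) (X : Set P) : Prop where
  mem : ∀ {a b}, E a b → a ∈ X ∧ b ∈ X
  refl : ∀ {a}, a ∈ X → E a a
  symm : ∀ {a b}, E a b → E b a
  trans : ∀ {a b c}, E a b → E b c → E a c

/-- The set of `E`-classes of an equivalence relation on `X`. -/
def classes {P : Type u} (E : P → P → Prop) (X : Set P) : Set (Set P) :=
  (fun a => {b | E a b}) '' X

/-- The restriction of a relation to a set. -/
def restrict {P : Type u} (E : P → P → Prop) (Z : Set P) : P → P → Prop :=
  fun a b => E a b ∧ a ∈ Z ∧ b ∈ Z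

/-- `Y` is `E`-saturated: it contains any class which it intersects. -/
def IsSaturatedFor {P : Type u} (E : P → P → Prop) (Y : Set P) : Prop :=
  ∀ a ∈ Y, ∀ b, E a b → b ∈ Y

/-- A relation on a product of sorts, as a subset of the square of that product. -/
def pairs {S : Type} {𝔐 : S → Type u} {V : Type v} {σ : V → S}
    (E : Tup 𝔐 σ → Tup 𝔐 σ → Prop) : Set (Tup 𝔐 (Sum.elim σ σ)) :=
  {c | ∃ a b, E a b ∧ c = a.append b}

/-- `E` is invariant (under all automorphisms of `𝔐`). -/
def IsInvariant {S : Type} (L : Lang S) {𝔐 : S → Type u} [Str L 𝔐] {V : Type v} {σ : V → S}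
    (E : Tup 𝔐 σ → Tup 𝔐 σ → Prop) : Prop :=
  ∀ g ∈ Aut L 𝔐, ∀ a b, E a b → E (act g a) (act g b)

/-- `E` is `F_σ`: it is invariant, and the corresponding subset of `S(∅)` is a countable union of
closed sets. -/
def IsFSigma {S : Type} (L : Lang S) {𝔐 : S → Type u} [Str L 𝔐] {V : Type v} {σ : V → S}
    (E : Tup 𝔐 σ → Tup 𝔐 σ → Prop) : Prop :=
  IsInvariant L E ∧ ∃ F : ℕ → Set (TypeSpace L (∅ : Params 𝔐) (Sum.elim σ σ)),
    (∀ n, IsClosed (F n)) ∧ typesOf L ∅ (pairs E) = ⋃ n, F n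

/-- `E`, an equivalence relation on `X`, is orbital: some group of automorphisms preserves each
class setwise and acts transitively on each class. -/
def IsOrbital {S : Type} (L : Lang S) {𝔐 : S → Type u} [Str L 𝔐] {V : Type v} {σ : V → S}
    (E : Tup 𝔐 σ → Tup 𝔐 σ → Prop) (X : Set (Tup 𝔐 σ)) : Prop :=
  ∃ Γ : Subgroup (∀ s, Equiv.Perm (𝔐 s)), Γ ≤ Aut L 𝔐 ∧
    ∀ C ∈ classes E X, (∀ g ∈ Γ, act g '' C = C) ∧ ∀ a ∈ C, ∀ b ∈ C, ∃ g ∈ Γ, act g a = b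

/-- `E`, an equivalence relation on `X`, is orbital on types: it refines equality of types over
`∅`, and its restriction to any complete type over `∅` is orbital. -/
def IsOrbitalOnTypes {S : Type} (L : Lang S) {𝔐 : S → Type u} [Str L 𝔐] {V : Type v}
    {σ : V → S} (E : Tup 𝔐 σ → Tup 𝔐 σ → Prop) (X : Set (Tup 𝔐 σ)) : Prop :=
  (∀ a b, E a b → tp L ∅ a = tp L ∅ b) ∧
    ∀ p : TypeSpace L (∅ : Params 𝔐) σ,
      IsOrbital L (restrict E {a | tp L ∅ a = p.1}) (X ∩ {a | tp L ∅ a = p.1})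

/-! ## Normal forms -/

/-- `d(a, b) = min {n | Φ n a b}`, with `min ∅ = ∞`. -/
noncomputable def dist {P : Type u} (Φ : ℕ → P → P → Prop) (a b : P) : ℕ∞ :=
  ⨅ (n : ℕ) (_ : Φ n a b), (n : ℕ∞)

/-- The sequence of partial types `Φ n` (identified with their sets of realisations) is a normal
form of the equivalence relation `E` on `X`. -/
structure IsNormalForm {S : Type} (L : Lang S) {𝔐 : S → Type u} [Str L 𝔐] {V : Type v}
    {σ : V → S} (Φ : ℕ → Tup 𝔐 σ → Tup 𝔐 σ → Prop) (E : Tup 𝔐 σ → Tup 𝔐 σ → Prop)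
    (X : Set (Tup 𝔐 σ)) : Prop where
  typeDefinable : ∀ n, IsTypeDefinableOver L ∅ (pairs (Φ n))
  mem : ∀ n a b, Φ n a b → a ∈ X ∧ b ∈ X
  zero : ∀ a b, Φ 0 a b ↔ a = b ∧ a ∈ X
  mono : ∀ n a b, Φ n a b → Φ (n + 1) a b
  equiv : ∀ a ∈ X, ∀ b ∈ X, E a b ↔ ∃ n, Φ n a b
  eq_of_dist : ∀ a ∈ X, ∀ b ∈ X, dist Φ a b = 0 ↔ a = b
  dist_symm : ∀ a ∈ X, ∀ b ∈ X, dist Φ a b = dist Φ b a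
  dist_triangle : ∀ a ∈ X, ∀ b ∈ X, ∀ c ∈ X, dist Φ a c ≤ dist Φ a b + dist Φ b c

/-- The diameter of a set with respect to the distance given by `Φ`. -/
noncomputable def diameter {P : Type u} (Φ : ℕ → P → P → Prop) (C : Set P) : ℕ∞ :=
  ⨆ a ∈ C, ⨆ b ∈ C, dist Φ a b

/-! ## Borel equivalence relations -/

/-- A relation on a topological space is smooth: it is Borel reducible to equality on a Polish
space. -/
def IsSmooth {T : Type u} [TopologicalSpace T] (R : T → T → Prop) : Prop :=
  ∃ (Z : Type) (_ : TopologicalSpace Z) (_ : PolishSpace Z) (f : T → Z),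
    @Measurable T Z (borel T) (borel Z) f ∧ ∀ x y, R x y ↔ f x = f y

/-- Eventual equality of binary sequences. -/
def E₀ (x y : ℕ → Bool) : Prop :=
  ∃ N, ∀ n ≥ N, x n = y n

/-- `E^A` on `S(A)`: `p` and `q` are related if they have `E`-related realisations. -/
def inducedRel {S : Type} (L : Lang S) {𝔐 : S → Type u} [Str L 𝔐] (A : Params 𝔐) {V : Type v}
    {σ : V → S} (E : Tup 𝔐 σ → Tup 𝔐 σ → Prop) (p q : TypeSpace L A σ) : Prop :=
  ∃ a b, TypeSpace.of L A a = p ∧ TypeSpace.of L A b = q ∧ E a b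

/-- The restriction of `E^A` to the subspace `Y_A` of `S(A)`. -/
def inducedRelOn {S : Type} (L : Lang S) {𝔐 : S → Type u} [Str L 𝔐] (A : Params 𝔐) {V : Type v}
    {σ : V → S} (E : Tup 𝔐 σ → Tup 𝔐 σ → Prop) (Y : Set (Tup 𝔐 σ))
    (p q : typesOf L A Y) : Prop :=
  inducedRel L A E p.1 q.1

/-- The restriction of `E` to `Y` is smooth: for a countable model `M`, the restriction of `E^M` to
`Y_M` is smooth. -/
def IsSmoothOn {S : Type} (L : Lang S) {𝔐 : S → Type u} [Str L 𝔐] {V : Type v} {σ : V → S}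
    (E : Tup 𝔐 σ → Tup 𝔐 σ → Prop) (Y : Set (Tup 𝔐 σ)) : Prop :=
  ∃ M : Substr L 𝔐, M.IsCountableModel ∧ IsSmooth (inducedRelOn L M.params E Y)

end ManySorted

-- On tuples with the type of a point of the unbounded class, the `E`-classes are orbits of a group
-- `Γ` of automorphisms. `Γ` need not fix a model `M`, so it does not act on types over `M`; it does
-- act on ultrafilters on the set of tuples, which play the role of global types. In the closure of
-- the unbounded class one picks an almost periodic ultrafilter `r` (`exists_almostPeriodic`): for
-- each `U ∈ r`, finitely many elements of `Γ` suffice to bring every `Γ`-translate of `r` back into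
-- `U`.
--
-- Boundedness of `E` forces every complete type over `M` inside `X` to have finite diameter: it
-- extends to a coheir, and realisations of a coheir stay within a bounded distance of one
-- representative (`IsNormalForm.exists_forall_tp_eq`). Hence, if the translates of `r` that meet a
-- neighbourhood `U` all stayed close to `r` over `M`, almost periodicity would bound the whole
-- orbit, contradicting the infinite diameter. So `r` can be moved within `U` arbitrarily far away,
-- the distance being witnessed by formulas over `M` (`exists_separating`).
--
-- Iterating gives elements `γ n` and a Cantor scheme whose set at `x` and level `n` is the
-- translate of a neighbourhood `V n` of `r` by the product of the `γ i` with `i < n` and `x i =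
-- true` (`exists_scheme`). The levels decide every formula over `M`, so each branch determines one
-- type over `M`, depending continuously on the branch; saturation realises it in the pseudo-closed
-- set `Y`. Branches with the same tail differ by left translation by one element of `Γ`, which
-- preserves classes. Branches that differ at `n` have types at distance greater than `n`, so
-- infinitely many differences exclude `E`. Non-smoothness then follows from that of `E₀`, by the
-- zero-one law.

universe w

namespace ManySorted

/-! ### Syntax: substitution, finite support, existential projection. -/

section Substitution

variable {S : Type} {L : Lang S}

/-- Substitution of terms for the variables of a term. -/
def Term.subst {V : Type v} {W : Type w} {σ : V → S} {σ' : W → S}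
    (ρ : ∀ x, Term L σ' (σ x)) : ∀ {s : S}, Term L σ s → Term L σ' s
  | _, .var x => ρ x
  | _, .func f ts => .func f fun k => (ts k).subst ρ

theorem Term.realize_subst {𝔐 : S → Type u} [Str L 𝔐] {V : Type v} {W : Type w} {σ : V → S}
    {σ' : W → S} (ρ : ∀ x, Term L σ' (σ x)) (c : Tup 𝔐 σ') {s : S} (t : Term L σ s) :
    (t.subst ρ).realize c = t.realize (fun x => (ρ x).realize c) := by
  induction t with
  | var x => rfl
  | func f ts ih =>
    simp only [Term.subst, Term.realize]
    congr 1
    funext k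
    exact ih k

/-- The variables of a context, seen in the context with one more bound variable. -/
def weaken {W : Type w} {σ : W → S} {m : ℕ} {τ : Fin m → S} (s : S) :
    ∀ y : W ⊕ Fin m,
      Term L (Sum.elim σ (Fin.cons (α := fun _ => S) s τ)) (Sum.elim σ τ y)
  | .inl w => Term.var (σ := Sum.elim σ (Fin.cons (α := fun _ => S) s τ)) (.inl w)
  | .inr j => Term.var (σ := Sum.elim σ (Fin.cons (α := fun _ => S) s τ)) (.inr j.succ)

/-- The extension of a substitution to one more bound variable. -/
def liftSubst {V : Type v} {W : Type w} {σ : V → S} {σ' : W → S} {n m : ℕ} {τ : Fin n → S}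
    {τ' : Fin m → S} (s : S)
    (ρ : ∀ x : V ⊕ Fin n, Term L (Sum.elim σ' τ') (Sum.elim σ τ x)) :
    ∀ x : V ⊕ Fin (n + 1), Term L (Sum.elim σ' (Fin.cons (α := fun _ => S) s τ'))
      (Sum.elim σ (Fin.cons (α := fun _ => S) s τ) x)
  | .inl v => (ρ (.inl v)).subst (weaken s)
  | .inr k => Fin.cases
      (motive := fun k => Term L (Sum.elim σ' (Fin.cons (α := fun _ => S) s τ'))
        (Sum.elim σ (Fin.cons (α := fun _ => S) s τ) (.inr k)))
      (Term.var (σ := Sum.elim σ' (Fin.cons (α := fun _ => S) s τ')) (.inr 0))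
      (fun k => (ρ (.inr k)).subst (weaken s)) k

/-- Substitution of terms for the variables of a formula, free or bound by outer quantifiers. -/
def BFormula.subst {V : Type v} {W : Type w} {σ : V → S} {σ' : W → S} :
    ∀ {n : ℕ} {τ : Fin n → S} {m : ℕ} {τ' : Fin m → S}
      (_ : ∀ x : V ⊕ Fin n, Term L (Sum.elim σ' τ') (Sum.elim σ τ x)),
      BFormula L σ n τ → BFormula L σ' m τ'
  | _, _, _, _, _, .falsum => .falsum
  | _, _, _, _, ρ, .equal t₁ t₂ => .equal (t₁.subst ρ) (t₂.subst ρ)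
  | _, _, _, _, ρ, .rel r ts => .rel r fun k => (ts k).subst ρ
  | _, _, _, _, ρ, .imp φ ψ => .imp (φ.subst ρ) (ψ.subst ρ)
  | _, _, _, _, ρ, .all s φ => .all s (φ.subst (liftSubst s ρ))

theorem realize_weaken {𝔐 : S → Type u} [Str L 𝔐] {W : Type w} {σ : W → S} {m : ℕ}
    {τ : Fin m → S} {s : S} (a : Tup 𝔐 σ) (b : Tup 𝔐 τ) (x : 𝔐 s) :
    (fun y => (weaken (L := L) s y).realize (a.append (consTup x b))) = a.append b := by
  funext y
  rcases y with w | j <;> rfl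

/-- The assignments on both sides are arbitrary and linked only by a hypothesis, so that the
induction can pass under a quantifier, where both acquire a new entry. -/
theorem BFormula.realize_subst {𝔐 : S → Type u} [Str L 𝔐] {V : Type v} {W : Type w}
    {σ : V → S} {σ' : W → S} {n : ℕ} {τ : Fin n → S} (φ : BFormula L σ n τ) :
    ∀ {m : ℕ} {τ' : Fin m → S} (ρ : ∀ x : V ⊕ Fin n, Term L (Sum.elim σ' τ') (Sum.elim σ τ x))
      (a' : Tup 𝔐 σ') (b' : Tup 𝔐 τ') (a : Tup 𝔐 σ) (b : Tup 𝔐 τ)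
      (_ : ∀ x, (ρ x).realize (a'.append b') = a.append b x),
      (φ.subst ρ).realize a' b' ↔ φ.realize a b := by
  induction φ with
  | falsum => intros; exact Iff.rfl
  | equal t₁ t₂ =>
    intro m τ' ρ a' b' a b h
    have h' : (fun x => (ρ x).realize (a'.append b')) = a.append b := funext h
    simp only [BFormula.subst, BFormula.realize, Term.realize_subst, h']
  | rel r ts =>
    intro m τ' ρ a' b' a b h
    have h' : (fun x => (ρ x).realize (a'.append b')) = a.append b := funext h
    simp only [BFormula.subst, BFormula.realize, Term.realize_subst, h']
  | imp φ ψ ih₁ ih₂ =>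
    intro m τ' ρ a' b' a b h
    simp only [BFormula.subst, BFormula.realize]
    rw [ih₁ ρ a' b' a b h, ih₂ ρ a' b' a b h]
  | all s φ ih =>
    intro m τ' ρ a' b' a b h
    simp only [BFormula.subst, BFormula.realize]
    refine forall_congr' fun x => ih _ _ _ _ _ ?_
    rintro (v | k)
    · change ((ρ (.inl v)).subst (weaken s)).realize (a'.append (consTup x b')) = _
      rw [Term.realize_subst, realize_weaken]
      exact h (.inl v)
    · refine Fin.cases ?_ (fun k => ?_) k
      · rfl
      · change ((ρ (.inr k)).subst (weaken s)).realize (a'.append (consTup x b')) = _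
        rw [Term.realize_subst, realize_weaken]
        exact h (.inr k)

/-- Substitution of terms for the free variables of a formula. -/
def Formula.subst {V : Type v} {W : Type w} {σ : V → S} {σ' : W → S}
    (ρ : ∀ x : V, Term L σ' (σ x)) (φ : Formula L σ) : Formula L σ' :=
  BFormula.subst (fun
    | .inl x => (ρ x).subst fun w => Term.var (σ := Sum.elim σ' Fin.elim0) (.inl w)
    | .inr k => k.elim0) φ

theorem Formula.sat_subst {𝔐 : S → Type u} [Str L 𝔐] {V : Type v} {W : Type w} {σ : V → S}
    {σ' : W → S} (ρ : ∀ x : V, Term L σ' (σ x)) (φ : Formula L σ) (a : Tup 𝔐 σ') :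
    Sat (Formula.subst ρ φ) a ↔ Sat φ (fun x => (ρ x).realize a) := by
  refine BFormula.realize_subst φ _ _ _ _ _ ?_
  rintro (x | k)
  · exact Term.realize_subst _ _ (ρ x)
  · exact k.elim0

/-- Every term uses finitely many variables. -/
theorem Term.exists_finset_support {V : Type v} {σ : V → S} {n : ℕ} {τ : Fin n → S} {s : S}
    (t : Term L (Sum.elim σ τ) s) :
    ∃ F : Finset V, ∀ G : Finset V, F ⊆ G →
      ∃ t' : Term L (Sum.elim (fun v : G => σ v) τ) s,
        ∀ (𝔐 : S → Type u) [Str L 𝔐] (a : Tup 𝔐 σ) (b : Tup 𝔐 τ),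
          t.realize (a.append b) = t'.realize (Tup.append (fun v : G => a v) b) := by
  classical
  induction t with
  | var x =>
    rcases x with x | k
    · exact ⟨{x}, fun G hG => ⟨Term.var (σ := Sum.elim (fun v : G => σ v) τ)
        (.inl ⟨x, hG (Finset.mem_singleton_self x)⟩), fun _ _ _ _ => rfl⟩⟩
    · exact ⟨∅, fun G _ => ⟨Term.var (σ := Sum.elim (fun v : G => σ v) τ) (.inr k),
        fun _ _ _ _ => rfl⟩⟩
  | func f ts ih =>
    choose F hF using ih
    -- Allowing every `G` above the support, rather than one minimal set, lets all subterms be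
    -- rewritten over the same `G`.
    refine ⟨Finset.univ.biUnion F, fun G hG => ?_⟩
    choose t' ht' using fun k =>
      hF k G ((Finset.subset_biUnion_of_mem F (Finset.mem_univ k)).trans hG)
    refine ⟨.func f t', fun 𝔐 _ a b => ?_⟩
    simp only [Term.realize]
    congr 1
    funext k
    exact ht' k 𝔐 a b

/-- Every formula uses finitely many free variables. -/
theorem BFormula.exists_finset_support {V : Type v} {σ : V → S} {n : ℕ} {τ : Fin n → S}
    (φ : BFormula L σ n τ) :
    ∃ F : Finset V, ∀ G : Finset V, F ⊆ G → ∃ ψ : BFormula L (fun v : G => σ v) n τ,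
      ∀ (𝔐 : S → Type u) [Str L 𝔐] (a : Tup 𝔐 σ) (b : Tup 𝔐 τ),
        φ.realize a b ↔ ψ.realize (fun v : G => a v) b := by
  classical
  induction φ with
  | falsum => exact ⟨∅, fun G _ => ⟨.falsum, fun _ _ _ _ => Iff.rfl⟩⟩
  | equal t₁ t₂ =>
    obtain ⟨F₁, h₁⟩ := Term.exists_finset_support.{u} t₁
    obtain ⟨F₂, h₂⟩ := Term.exists_finset_support.{u} t₂
    refine ⟨F₁ ∪ F₂, fun G hG => ?_⟩
    obtain ⟨t₁', h₁⟩ := h₁ G (Finset.subset_union_left.trans hG)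
    obtain ⟨t₂', h₂⟩ := h₂ G (Finset.subset_union_right.trans hG)
    refine ⟨.equal t₁' t₂', fun 𝔐 _ a b => ?_⟩
    simp only [BFormula.realize, h₁ 𝔐 a b, h₂ 𝔐 a b]
  | rel r ts =>
    choose F hF using fun k => Term.exists_finset_support.{u} (ts k)
    refine ⟨Finset.univ.biUnion F, fun G hG => ?_⟩
    choose t' ht' using fun k =>
      hF k G ((Finset.subset_biUnion_of_mem F (Finset.mem_univ k)).trans hG)
    refine ⟨.rel r t', fun 𝔐 _ a b => ?_⟩
    simp only [BFormula.realize, ht' _ 𝔐 a b]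
  | imp φ ψ ih₁ ih₂ =>
    obtain ⟨F₁, h₁⟩ := ih₁
    obtain ⟨F₂, h₂⟩ := ih₂
    refine ⟨F₁ ∪ F₂, fun G hG => ?_⟩
    obtain ⟨t₁', h₁⟩ := h₁ G (Finset.subset_union_left.trans hG)
    obtain ⟨t₂', h₂⟩ := h₂ G (Finset.subset_union_right.trans hG)
    refine ⟨.imp t₁' t₂', fun 𝔐 _ a b => ?_⟩
    simp only [BFormula.realize, h₁ 𝔐 a b, h₂ 𝔐 a b]
  | all s φ ih =>
    obtain ⟨F, h⟩ := ih
    refine ⟨F, fun G hG => ?_⟩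
    obtain ⟨ψ, h⟩ := h G hG
    refine ⟨.all s ψ, fun 𝔐 _ a b => ?_⟩
    simp only [BFormula.realize, h 𝔐 a]

/-- The negation of a formula. -/
def BFormula.neg {V : Type v} {σ : V → S} {n : ℕ} {τ : Fin n → S} (φ : BFormula L σ n τ) :
    BFormula L σ n τ :=
  .imp φ .falsum

/-- Existential closure of the variables bound by outer quantifiers. -/
theorem BFormula.exists_existsClosure {V : Type v} {σ : V → S} :
    ∀ {n : ℕ} {τ : Fin n → S} (φ : BFormula L σ n τ), ∃ ψ : Formula L σ,
      ∀ (𝔐 : S → Type u) [Str L 𝔐] (a : Tup 𝔐 σ), Sat ψ a ↔ ∃ b : Tup 𝔐 τ, φ.realize a b := by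
  intro n
  induction n with
  | zero =>
    intro τ φ
    obtain rfl : τ = Fin.elim0 := Subsingleton.elim _ _
    refine ⟨φ, fun 𝔐 _ a => ⟨fun h => ⟨_, h⟩, fun ⟨b, hb⟩ => ?_⟩⟩
    obtain rfl : b = fun k => k.elim0 := funext fun k => k.elim0
    exact hb
  | succ n ih =>
    intro τ φ
    obtain ⟨s, τ, rfl⟩ : ∃ s τ', τ = Fin.cons (α := fun _ => S) s τ' :=
      ⟨τ 0, Fin.tail τ, (Fin.cons_self_tail τ).symm⟩
    obtain ⟨ψ, hψ⟩ := ih (BFormula.neg (.all s φ.neg))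
    refine ⟨ψ, fun 𝔐 _ a => (hψ 𝔐 a).trans ⟨?_, ?_⟩⟩
    · rintro ⟨b, hb⟩
      by_contra hne
      exact hb fun x hx => hne ⟨_, hx⟩
    · rintro ⟨b, hb⟩
      refine ⟨fun k => b k.succ, fun h => h (b 0) ?_⟩
      have : consTup (b 0) (fun k : Fin n => b k.succ) = b := by
        funext k
        refine Fin.cases rfl (fun k => rfl) k
      exact this.symm ▸ hb

/-- A tuple indexed by a subset of the variables extends to all variables. -/
theorem Tup.exists_extend {𝔐 : S → Type u} {V : Type v} {K : Type w} {σ : V → S} {i : K → V}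
    (hi : Function.Injective i) [Nonempty (Tup 𝔐 σ)] (c : Tup 𝔐 fun k => σ (i k)) :
    ∃ a : Tup 𝔐 σ, ∀ k, a (i k) = c k := by
  classical
  refine ⟨fun v => if h : ∃ k, i k = v then h.choose_spec ▸ c h.choose
    else (Classical.arbitrary (Tup 𝔐 σ)) v, fun k => ?_⟩
  have h : ∃ k', i k' = i k := ⟨k, rfl⟩
  have key : ∀ k' (hk : i k' = i k), (hk ▸ c k' : 𝔐 (σ (i k))) = c k := by
    intro k' hk
    obtain rfl := hi hk
    rfl
  simp only [h, ↓reduceDIte]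
  exact key _ h.choose_spec

/-- Existential quantification over a tuple of variables, possibly infinite. -/
theorem Formula.exists_projection {V : Type v} {W : Type w} {σ : V → S} {σ' : W → S}
    (φ : Formula L (Sum.elim σ σ')) : ∃ ψ : Formula L σ',
      ∀ (𝔐 : S → Type u) [Str L 𝔐] [Nonempty (Tup 𝔐 σ)] (b : Tup 𝔐 σ'),
        Sat ψ b ↔ ∃ a : Tup 𝔐 σ, Sat φ (a.append b) := by
  classical
  obtain ⟨F, hF⟩ := BFormula.exists_finset_support.{u} φ
  obtain ⟨φ', hφ'⟩ := hF F subset_rfl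
  -- Only the finitely many variables of `σ` that occur in the formula become bound variables; the
  -- others are irrelevant once some tuple of sorts `σ` exists.
  obtain ⟨n, i, hi, hiF⟩ : ∃ (n : ℕ) (i : Fin n → V), Function.Injective i ∧
      ∀ v, Sum.inl v ∈ F → ∃ k, i k = v := by
    let G : Finset V := F.preimage Sum.inl Sum.inl_injective.injOn
    refine ⟨G.card, fun k => G.equivFin.symm k,
      Subtype.val_injective.comp G.equivFin.symm.injective, fun v hv => ?_⟩
    exact ⟨G.equivFin ⟨v, Finset.mem_preimage.2 hv⟩, by simp⟩
  have hρ : ∀ x : F, ∃ t : Term L (Sum.elim σ' fun k => σ (i k)) (Sum.elim σ σ' x),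
      ∀ (𝔐 : S → Type u) [Str L 𝔐] (a : Tup 𝔐 σ) (b : Tup 𝔐 σ'),
        t.realize (Tup.append b fun k => a (i k)) = a.append b x := by
    rintro ⟨v | x, hx⟩
    · obtain ⟨k, rfl⟩ := hiF v hx
      exact ⟨Term.var (σ := Sum.elim σ' fun k => σ (i k)) (.inr k), fun _ _ _ _ => rfl⟩
    · exact ⟨Term.var (σ := Sum.elim σ' fun k => σ (i k)) (.inl x), fun _ _ _ _ => rfl⟩
  choose ρ hρ using hρ
  let θ : BFormula L σ' n (fun k => σ (i k)) :=
    BFormula.subst (fun | .inl x => ρ x | .inr k => k.elim0) φ'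
  have hθ : ∀ (𝔐 : S → Type u) [Str L 𝔐] (a : Tup 𝔐 σ) (b : Tup 𝔐 σ'),
      θ.realize b (fun k => a (i k)) ↔ Sat φ (a.append b) := by
    intro 𝔐 _ a b
    rw [Sat, hφ' 𝔐]
    refine BFormula.realize_subst φ' _ _ _ _ _ ?_
    rintro (x | k)
    · exact hρ x 𝔐 a b
    · exact k.elim0
  obtain ⟨ψ, hψ⟩ := BFormula.exists_existsClosure.{u} θ
  refine ⟨ψ, fun 𝔐 _ _ b => (hψ 𝔐 b).trans ⟨?_, ?_⟩⟩
  · rintro ⟨c, hc⟩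
    obtain ⟨a, ha⟩ := Tup.exists_extend hi c
    obtain rfl : (fun k => a (i k)) = c := funext ha
    exact ⟨a, (hθ 𝔐 a b).1 hc⟩
  · rintro ⟨a, ha⟩
    exact ⟨_, (hθ 𝔐 a b).2 ha⟩

end Substitution

/-! ### Countability of the sets of terms and formulas. -/

section Countability

variable {S : Type} {L : Lang S} {V : Type v} {σ : V → S}

/-- The height of the syntax tree of a term. -/
def Term.height : ∀ {s : S}, Term L σ s → ℕ
  | _, .var _ => 0
  | _, .func _ ts => (Finset.univ.sup fun k => (ts k).height) + 1

/-- The height of the syntax tree of a formula above its atomic subformulas. -/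
def BFormula.height : ∀ {n : ℕ} {τ : Fin n → S}, BFormula L σ n τ → ℕ
  | _, _, .falsum => 0
  | _, _, .equal _ _ => 0
  | _, _, .rel _ _ => 0
  | _, _, .imp φ ψ => max φ.height ψ.height + 1
  | _, _, .all _ φ => φ.height + 1

/-- Terms below a given height are counted by induction: a function symbol has finitely many
arguments, so it contributes the image of a finite product of countable sets. The casts reconcile
the sort of a constructor with `s`. -/
instance Term.countable [Countable L.Fun] [Countable V] (s : S) : Countable (Term L σ s) := by
  have h : ∀ d : ℕ, ∀ s, {t : Term L σ s | t.height < d}.Countable := by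
    intro d
    induction d with
    | zero => intro s; simp
    | succ d ih =>
      intro s
      have hfun : ∀ f : L.Fun, (Set.univ.pi fun k : Fin (L.arity f) =>
          {t : Term L σ (L.dom f k) | t.height < d}).Countable :=
        fun f => Set.countable_univ_pi fun k => ih _
      refine Set.Countable.mono (s₂ := (⋃ (x : V) (h : σ x = s), {h ▸ Term.var x}) ∪
        ⋃ (f : L.Fun) (h : L.cod f = s), (fun ts => (h ▸ Term.func f ts : Term L σ s)) ''
          (Set.univ.pi fun k : Fin (L.arity f) => {t : Term L σ (L.dom f k) | t.height < d}))
        ?_ ?_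
      · intro t ht
        cases t with
        | var x => exact Or.inl (Set.mem_iUnion₂.2 ⟨x, rfl, rfl⟩)
        | func f ts =>
          refine Or.inr (Set.mem_iUnion₂.2 ⟨f, rfl, ts, fun k _ => ?_, rfl⟩)
          have ht' : (Finset.univ.sup fun k => (ts k).height) + 1 < d + 1 := ht
          exact (Finset.le_sup (f := fun k => (ts k).height) (Finset.mem_univ k)).trans_lt
            (Nat.lt_of_succ_lt_succ ht')
      · exact (Set.countable_iUnion fun x => Set.countable_iUnion fun _ =>
          Set.countable_singleton _).union
          (Set.countable_iUnion fun f => Set.countable_iUnion fun _ => (hfun f).image _)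
  refine Set.countable_univ_iff.1 ((Set.countable_iUnion fun d => h d s).mono fun t _ => ?_)
  exact Set.mem_iUnion.2 ⟨t.height + 1, Nat.lt_succ_self _⟩

instance BFormula.countable [Countable S] [Countable L.Fun] [Countable L.Rel] [Countable V]
    (n : ℕ) (τ : Fin n → S) : Countable (BFormula L σ n τ) := by
  have h : ∀ d : ℕ, ∀ n τ, {φ : BFormula L σ n τ | φ.height < d}.Countable := by
    intro d
    induction d with
    | zero => intro n τ; simp
    | succ d ih =>
      intro n τ
      refine Set.Countable.mono (s₂ := {.falsum} ∪
        (⋃ s, Set.range fun t : Term L (Sum.elim σ τ) s × Term L (Sum.elim σ τ) s =>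
          BFormula.equal t.1 t.2) ∪
        (⋃ r, Set.range fun ts : ∀ k, Term L (Sum.elim σ τ) (L.relDom r k) =>
          BFormula.rel r ts) ∪
        Set.image2 .imp {φ | φ.height < d} {φ | φ.height < d} ∪
        ⋃ s, BFormula.all s '' {φ | φ.height < d}) ?_ ?_
      · intro φ hφ
        cases φ with
        | falsum => exact Or.inl (Or.inl (Or.inl (Or.inl rfl)))
        | equal t₁ t₂ =>
          exact Or.inl (Or.inl (Or.inl (Or.inr (Set.mem_iUnion.2 ⟨_, (t₁, t₂), rfl⟩))))
        | rel r ts => exact Or.inl (Or.inl (Or.inr (Set.mem_iUnion.2 ⟨_, ts, rfl⟩)))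
        | imp φ ψ =>
          have hφ' : max φ.height ψ.height + 1 < d + 1 := hφ
          have := Nat.lt_of_succ_lt_succ hφ'
          exact Or.inl (Or.inr ⟨φ, (le_max_left _ _).trans_lt this, ψ,
            (le_max_right _ _).trans_lt this, rfl⟩)
        | all s φ =>
          exact Or.inr (Set.mem_iUnion.2 ⟨s, φ, Nat.lt_of_succ_lt_succ hφ, rfl⟩)
      · refine ((((Set.countable_singleton _).union ?_).union ?_).union ?_).union ?_
        · exact Set.countable_iUnion fun s => Set.countable_range _
        · exact Set.countable_iUnion fun s => Set.countable_range _
        · exact (ih _ _).image2 (ih _ _) _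
        · exact Set.countable_iUnion fun s => (ih _ _).image _
  refine Set.countable_univ_iff.1 ((Set.countable_iUnion fun d => h d n τ).mono fun t _ => ?_)
  exact Set.mem_iUnion.2 ⟨t.height + 1, Nat.lt_succ_self _⟩

end Countability

/-! ### Definable sets, types and the action of automorphisms. -/

section Definability

variable {S : Type} (L : Lang S) {𝔐 : S → Type u} [Str L 𝔐]

/-- `D` is the set of realisations of a formula over `A`. -/
def DefOver (A : Params 𝔐) {V : Type v} {σ : V → S} (D : Set (Tup 𝔐 σ)) : Prop :=
  ∃ φ : FormulaOver L A σ, D = {a | SatOver φ a}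

variable {L} {A B : Params 𝔐} {V : Type v} {W : Type w} {σ : V → S} {τ : W → S}

/-- The common source of the closure properties below: a map whose coordinates are given by terms
with parameters pulls formulas back by substitution. -/
theorem DefOver.preimage {D : Set (Tup 𝔐 σ)} (hD : DefOver L A D) (F : Tup 𝔐 τ → Tup 𝔐 σ)
    (h : ∀ x : V ⊕ A, ∃ t : Term L (Sum.elim τ B.sort) (Sum.elim σ A.sort x),
      ∀ a, t.realize (a.append B.self) = (F a).append A.self x) : DefOver L B (F ⁻¹' D) := by
  obtain ⟨φ, rfl⟩ := hD
  choose ρ hρ using h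
  refine ⟨Formula.subst ρ φ, Set.ext fun a => ?_⟩
  change Sat φ _ ↔ Sat (Formula.subst ρ φ) _
  rw [Formula.sat_subst]
  simp only [hρ]

theorem DefOver.compl {D : Set (Tup 𝔐 σ)} (hD : DefOver L A D) : DefOver L A Dᶜ := by
  obtain ⟨φ, rfl⟩ := hD
  exact ⟨BFormula.neg φ, rfl⟩

theorem DefOver.inter {D D' : Set (Tup 𝔐 σ)} (hD : DefOver L A D) (hD' : DefOver L A D') :
    DefOver L A (D ∩ D') := by
  obtain ⟨φ, rfl⟩ := hD
  obtain ⟨ψ, rfl⟩ := hD'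
  refine ⟨BFormula.neg (.imp φ (BFormula.neg ψ)), Set.ext fun a => ?_⟩
  change (SatOver φ a ∧ SatOver ψ a) ↔ ((SatOver φ a → (SatOver ψ a → False)) → False)
  tauto

theorem DefOver.univ : DefOver L A (Set.univ : Set (Tup 𝔐 σ)) :=
  ⟨BFormula.neg .falsum, Set.ext fun _ => ⟨fun _ h => h, fun _ => trivial⟩⟩

theorem DefOver.mono {D : Set (Tup 𝔐 σ)} (hD : DefOver L A D) (hAB : A ⊆ B) :
    DefOver L B D := by
  refine hD.preimage (F := id) ?_
  rintro (v | x)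
  · exact ⟨Term.var (σ := Sum.elim σ B.sort) (.inl v), fun _ => rfl⟩
  · exact ⟨Term.var (σ := Sum.elim σ B.sort) (.inr ⟨x, hAB x.2⟩), fun _ => rfl⟩

theorem DefOver.eval_eq {i : V} {x : 𝔐 (σ i)} (hx : ⟨σ i, x⟩ ∈ A) :
    DefOver L A {a : Tup 𝔐 σ | a i = x} :=
  ⟨.equal (Term.var (σ := Sum.elim (Sum.elim σ A.sort) Fin.elim0) (.inl (.inl i)))
    (Term.var (σ := Sum.elim (Sum.elim σ A.sort) Fin.elim0) (.inl (.inr ⟨_, hx⟩))), rfl⟩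

/-- The set of elements of a tuple. -/
def Tup.params (c : Tup 𝔐 τ) : Params 𝔐 :=
  Set.range fun j => (⟨τ j, c j⟩ : Σ s, 𝔐 s)

theorem DefOver.section_left {D : Set (Tup 𝔐 (Sum.elim σ τ))} (hD : DefOver L A D) (hAB : A ⊆ B)
    {c : Tup 𝔐 τ} (hc : c.params ⊆ B) : DefOver L B {a : Tup 𝔐 σ | a.append c ∈ D} := by
  refine hD.preimage (F := fun a : Tup 𝔐 σ => a.append c) ?_
  rintro ((v | w) | x)
  · exact ⟨Term.var (σ := Sum.elim σ B.sort) (.inl v), fun _ => rfl⟩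
  · exact ⟨Term.var (σ := Sum.elim σ B.sort) (.inr ⟨_, hc ⟨w, rfl⟩⟩), fun _ => rfl⟩
  · exact ⟨Term.var (σ := Sum.elim σ B.sort) (.inr ⟨x, hAB x.2⟩), fun _ => rfl⟩

theorem DefOver.section_right {D : Set (Tup 𝔐 (Sum.elim τ σ))} (hD : DefOver L A D) (hAB : A ⊆ B)
    {c : Tup 𝔐 τ} (hc : c.params ⊆ B) : DefOver L B {a : Tup 𝔐 σ | c.append a ∈ D} := by
  refine hD.preimage (F := fun a : Tup 𝔐 σ => c.append a) ?_
  rintro ((v | w) | x)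
  · exact ⟨Term.var (σ := Sum.elim σ B.sort) (.inr ⟨_, hc ⟨v, rfl⟩⟩), fun _ => rfl⟩
  · exact ⟨Term.var (σ := Sum.elim σ B.sort) (.inl w), fun _ => rfl⟩
  · exact ⟨Term.var (σ := Sum.elim σ B.sort) (.inr ⟨x, hAB x.2⟩), fun _ => rfl⟩

theorem DefOver.inl_preimage {D : Set (Tup 𝔐 σ)} (hD : DefOver L A D) :
    DefOver L A {c : Tup 𝔐 (Sum.elim σ τ) | (fun v => c (.inl v) : Tup 𝔐 σ) ∈ D} := by
  refine hD.preimage (F := fun c : Tup 𝔐 (Sum.elim σ τ) => (fun v => c (.inl v) : Tup 𝔐 σ)) ?_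
  rintro (v | x)
  · exact ⟨Term.var (σ := Sum.elim (Sum.elim σ τ) A.sort) (.inl (.inl v)), fun _ => rfl⟩
  · exact ⟨Term.var (σ := Sum.elim (Sum.elim σ τ) A.sort) (.inr x), fun _ => rfl⟩

theorem DefOver.inr_preimage {D : Set (Tup 𝔐 τ)} (hD : DefOver L A D) :
    DefOver L A {c : Tup 𝔐 (Sum.elim σ τ) | (fun v => c (.inr v) : Tup 𝔐 τ) ∈ D} := by
  refine hD.preimage (F := fun c : Tup 𝔐 (Sum.elim σ τ) => (fun v => c (.inr v) : Tup 𝔐 τ)) ?_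
  rintro (v | x)
  · exact ⟨Term.var (σ := Sum.elim (Sum.elim σ τ) A.sort) (.inl (.inr v)), fun _ => rfl⟩
  · exact ⟨Term.var (σ := Sum.elim (Sum.elim σ τ) A.sort) (.inr x), fun _ => rfl⟩

theorem DefOver.exists_finset_support {D : Set (Tup 𝔐 σ)} (hD : DefOver L A D) :
    ∃ F : Finset V, ∀ a b : Tup 𝔐 σ, (∀ i ∈ F, a i = b i) → a ∈ D → b ∈ D := by
  classical
  obtain ⟨φ, rfl⟩ := hD
  obtain ⟨F, hF⟩ := BFormula.exists_finset_support.{u} φ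
  obtain ⟨ψ, hψ⟩ := hF F subset_rfl
  refine ⟨F.preimage Sum.inl Sum.inl_injective.injOn, fun a b hab ha => ?_⟩
  change Sat φ _ at ha
  change Sat φ _
  rw [Sat, hψ 𝔐] at ha ⊢
  convert ha using 1
  funext x
  obtain ⟨v | y, hx⟩ := x
  · exact (hab v (Finset.mem_preimage.2 hx)).symm
  · rfl

theorem DefOver.image_eval {D : Set (Tup 𝔐 σ)} (hD : DefOver L A D) [Nonempty (Tup 𝔐 σ)] (i : V) :
    DefOver L A {x : Tup 𝔐 (fun _ : Unit => σ i) | ∃ a ∈ D, a i = x ()} := by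
  have hD' : DefOver L A {c : Tup 𝔐 (Sum.elim σ fun _ : Unit => σ i) |
      (fun v => c (.inl v) : Tup 𝔐 σ) ∈ D ∧ c (.inl i) = c (.inr ())} := by
    refine hD.inl_preimage.inter (D' := {c | c (.inl i) = c (.inr ())}) ⟨.equal
      (Term.var (σ := Sum.elim (Sum.elim (Sum.elim σ fun _ : Unit => σ i) A.sort) Fin.elim0)
        (.inl (.inl (.inl i))))
      (Term.var (σ := Sum.elim (Sum.elim (Sum.elim σ fun _ : Unit => σ i) A.sort) Fin.elim0)
        (.inl (.inl (.inr ())))), rfl⟩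
  obtain ⟨φ, hφ⟩ := hD'
  -- The variables are reassociated so that the block to be projected away is the whole left summand
  -- and the parameters go with the remaining variable.
  let φ' : Formula L (Sum.elim σ (Sum.elim (fun _ : Unit => σ i) A.sort)) :=
    Formula.subst (fun
      | .inl (.inl v) =>
        Term.var (σ := Sum.elim σ (Sum.elim (fun _ : Unit => σ i) A.sort)) (.inl v)
      | .inl (.inr x) =>
        Term.var (σ := Sum.elim σ (Sum.elim (fun _ : Unit => σ i) A.sort)) (.inr (.inl x))
      | .inr x =>
        Term.var (σ := Sum.elim σ (Sum.elim (fun _ : Unit => σ i) A.sort)) (.inr (.inr x))) φ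
  obtain ⟨ψ, hψ⟩ := Formula.exists_projection.{u} φ'
  refine ⟨ψ, Set.ext fun x => Iff.trans ?_ (hψ 𝔐 (x.append A.self)).symm⟩
  refine exists_congr fun a => ?_
  have h1 : (a.append x ∈ {c : Tup 𝔐 (Sum.elim σ fun _ : Unit => σ i) |
      (fun v => c (.inl v) : Tup 𝔐 σ) ∈ D ∧ c (.inl i) = c (.inr ())}) ↔ SatOver φ (a.append x) := by
    rw [hφ]; rfl
  refine h1.trans ?_
  rw [Formula.sat_subst]
  refine iff_of_eq (congrArg (Sat φ) ?_)
  funext y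
  rcases y with (v | y) | y <;> rfl

theorem tp_eq_iff {a b : Tup 𝔐 σ} :
    tp L A a = tp L A b ↔ ∀ D : Set (Tup 𝔐 σ), DefOver L A D → (a ∈ D ↔ b ∈ D) := by
  constructor
  · rintro h _ ⟨φ, rfl⟩
    exact Set.ext_iff.1 h φ
  · exact fun h => Set.ext fun φ => h _ ⟨φ, rfl⟩

theorem tp_eq_of_forall_imp {a b : Tup 𝔐 σ}
    (h : ∀ D : Set (Tup 𝔐 σ), DefOver L A D → a ∈ D → b ∈ D) : tp L A a = tp L A b :=
  tp_eq_iff.2 fun D hD => ⟨h D hD, fun hb => by_contra fun ha => h _ hD.compl ha hb⟩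

theorem tp_eq_mono {a b : Tup 𝔐 σ} (hAB : A ⊆ B) (h : tp L B a = tp L B b) :
    tp L A a = tp L A b :=
  tp_eq_iff.2 fun D hD => tp_eq_iff.1 h D (hD.mono hAB)

theorem IsTypeDefinableOver.exists_family {X : Set (Tup 𝔐 σ)} (hX : IsTypeDefinableOver L A X) :
    ∃ 𝓓 : Set (Set (Tup 𝔐 σ)), (∀ D ∈ 𝓓, DefOver L A D) ∧ X = ⋂₀ 𝓓 := by
  obtain ⟨Φ, rfl⟩ := hX
  refine ⟨(fun φ => {a | SatOver φ a}) '' Φ, ?_, ?_⟩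
  · rintro _ ⟨φ, _, rfl⟩
    exact ⟨φ, rfl⟩
  · ext a
    simp

theorem IsTypeDefinableOver.mem_of_tp_eq {X : Set (Tup 𝔐 σ)} (hX : IsTypeDefinableOver L A X)
    {a b : Tup 𝔐 σ} (h : tp L A a = tp L A b) (ha : a ∈ X) : b ∈ X := by
  obtain ⟨𝓓, h𝓓, rfl⟩ := hX.exists_family
  exact fun D hD => (tp_eq_iff.1 h D (h𝓓 D hD)).1 (ha D hD)

/-! ### Automorphisms -/

theorem act_one (a : Tup 𝔐 σ) : act 1 a = a := rfl

theorem act_mul (g h : ∀ s, Equiv.Perm (𝔐 s)) (a : Tup 𝔐 σ) :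
    act (g * h) a = act g (act h a) := rfl

theorem act_inv_act (g : ∀ s, Equiv.Perm (𝔐 s)) (a : Tup 𝔐 σ) : act g⁻¹ (act g a) = a := by
  rw [← act_mul, inv_mul_cancel, act_one]

theorem act_append (g : ∀ s, Equiv.Perm (𝔐 s)) (a : Tup 𝔐 σ) (b : Tup 𝔐 τ) :
    act g (a.append b) = (act g a).append (act g b) := by
  funext x
  rcases x with v | w <;> rfl

theorem act_consTup (g : ∀ s, Equiv.Perm (𝔐 s)) {n : ℕ} {τ : Fin n → S} {s : S} (x : 𝔐 s)
    (b : Tup 𝔐 τ) : act g (consTup x b) = consTup (g s x) (act g b) := by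
  funext k
  refine Fin.cases rfl (fun k => rfl) k

theorem Term.realize_act {g : ∀ s, Equiv.Perm (𝔐 s)} (hg : g ∈ Aut L 𝔐) (a : Tup 𝔐 σ) {s : S}
    (t : Term L σ s) : t.realize (act g a) = g s (t.realize a) := by
  induction t with
  | var x => rfl
  | func f ts ih =>
    simp only [Term.realize, ih]
    exact (hg.1 f _).symm

theorem BFormula.realize_act {g : ∀ s, Equiv.Perm (𝔐 s)} (hg : g ∈ Aut L 𝔐) (a : Tup 𝔐 σ) {n : ℕ}
    {τ : Fin n → S} (φ : BFormula L σ n τ) :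
    ∀ b : Tup 𝔐 τ, φ.realize (act g a) (act g b) ↔ φ.realize a b := by
  induction φ with
  | falsum => exact fun _ => Iff.rfl
  | equal t₁ t₂ =>
    intro b
    simp only [BFormula.realize, ← act_append, Term.realize_act hg, EmbeddingLike.apply_eq_iff_eq]
  | rel r ts =>
    intro b
    simp only [BFormula.realize, ← act_append, Term.realize_act hg]
    exact hg.2 r _
  | imp φ ψ ih₁ ih₂ =>
    intro b
    simp only [BFormula.realize, ih₁, ih₂]
  | all s φ ih =>
    intro b
    simp only [BFormula.realize]
    rw [(g s).forall_congr_right (q := fun x => φ.realize (act g a) (consTup x (act g b))) |>.symm]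
    simp only [← act_consTup, ih]

theorem sat_act {g : ∀ s, Equiv.Perm (𝔐 s)} (hg : g ∈ Aut L 𝔐) (φ : Formula L σ) (a : Tup 𝔐 σ) :
    Sat φ (act g a) ↔ Sat φ a := by
  refine Iff.trans ?_ (BFormula.realize_act hg a φ fun k => k.elim0)
  rw [Sat]
  exact iff_of_eq (congrArg _ (funext fun k => k.elim0))

/-- The image of a parameter set under a family of permutations. -/
def Params.image (g : ∀ s, Equiv.Perm (𝔐 s)) (A : Params 𝔐) : Params 𝔐 :=
  (fun x => ⟨x.1, g x.1 x.2⟩) '' A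

/-- Applying `g` to the variables of a formula amounts to applying `g⁻¹` to its parameters.
Translates of sets definable over `M` therefore leave the realm of `M`-definable sets but stay
countably definable. -/
theorem DefOver.preimage_act {g : ∀ s, Equiv.Perm (𝔐 s)} (hg : g ∈ Aut L 𝔐)
    {D : Set (Tup 𝔐 σ)} (hD : DefOver L A D) : DefOver L (A.image g⁻¹) (act g ⁻¹' D) := by
  obtain ⟨φ, rfl⟩ := hD
  let ρ : ∀ x : V ⊕ A, Term L (Sum.elim σ (A.image g⁻¹).sort) (Sum.elim σ A.sort x) := fun
    | .inl v => Term.var (σ := Sum.elim σ (A.image g⁻¹).sort) (.inl v)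
    | .inr x => Term.var (σ := Sum.elim σ (A.image g⁻¹).sort) (.inr ⟨_, x, x.2, rfl⟩)
  refine ⟨Formula.subst ρ φ, Set.ext fun a => ?_⟩
  change Sat φ _ ↔ Sat (Formula.subst ρ φ) _
  rw [Formula.sat_subst, ← sat_act hg φ (fun x => (ρ x).realize (a.append (A.image g⁻¹).self))]
  refine iff_of_eq (congrArg (Sat φ) ?_)
  funext x
  rcases x with v | x
  · rfl
  · exact ((g x.1.1).apply_symm_apply x.1.2).symm

theorem DefOver.act_mem_iff {g : ∀ s, Equiv.Perm (𝔐 s)} (hg : g ∈ Aut L 𝔐)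
    (hgA : ∀ x ∈ A, g x.1 x.2 = x.2) {D : Set (Tup 𝔐 σ)} (hD : DefOver L A D) (a : Tup 𝔐 σ) :
    act g a ∈ D ↔ a ∈ D := by
  obtain ⟨φ, rfl⟩ := hD
  change Sat φ _ ↔ Sat φ _
  rw [← sat_act hg φ (a.append A.self), act_append]
  refine iff_of_eq (congrArg (fun c => Sat φ ((act g a).append c)) ?_)
  funext x
  exact (hgA x.1 x.2).symm

theorem tp_act {g : ∀ s, Equiv.Perm (𝔐 s)} (hg : g ∈ Aut L 𝔐)
    (hgA : ∀ x ∈ A, g x.1 x.2 = x.2) (a : Tup 𝔐 σ) : tp L A (act g a) = tp L A a :=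
  tp_eq_iff.2 fun _ hD => hD.act_mem_iff hg hgA a

end Definability

/-! ### Saturation and homogeneity for countable tuples; elementary substructures. -/

section Monster

open Filter

variable {S : Type} {L : Lang S} {𝔐 : S → Type u} [Str L 𝔐] {κ : Cardinal.{u}}

theorem mk_union_lt (hκ : Cardinal.aleph0 ≤ κ) {A B : Params 𝔐} (hA : Cardinal.mk A < κ)
    (hB : Cardinal.mk B < κ) : Cardinal.mk ↑(A ∪ B) < κ :=
  (Cardinal.mk_union_le A B).trans_lt (Cardinal.add_lt_of_lt hκ hA hB)

theorem Tup.countable_params {I : Type v} [Countable I] {σ : I → S} (c : Tup 𝔐 σ) :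
    c.params.Countable :=
  Set.countable_range _

/-- One coordinate of a partial type can be fixed. -/
theorem IsSaturated.exists_eval_eq (hsat : IsSaturated L 𝔐 κ) {I : Type v} {σ : I → S}
    (𝓕 : Filter (Tup 𝔐 σ)) [𝓕.NeBot] {A : Params 𝔐} (hA : Cardinal.mk A < κ)
    (h𝓕 : ∀ D ∈ 𝓕, ∃ B ∈ 𝓕, B ⊆ D ∧ DefOver L A B) (i : I) :
    ∃ x, (𝓕 ⊓ 𝓟 {a | a i = x}).NeBot := by
  have hne : Nonempty (Tup 𝔐 σ) := 𝓕.nonempty_of_neBot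
  -- The type to realise consists of the formulas that hold of the `i`-th coordinate eventually
  -- along `𝓕`.
  obtain ⟨x, hx⟩ := hsat A hA (σ i) {ψ | ∀ᶠ a in 𝓕, SatOver ψ (fun _ : Unit => a i)} (by
    intro Φ₀ hΦ₀
    have : ∀ᶠ a in 𝓕, ∀ ψ ∈ Φ₀, SatOver ψ (fun _ : Unit => a i) :=
      (Filter.eventually_all_finset Φ₀).2 fun ψ hψ => hΦ₀ hψ
    obtain ⟨a, ha⟩ := this.exists
    exact ⟨a i, ha⟩)
  refine ⟨x, Filter.inf_principal_neBot_iff.2 fun D hD => ?_⟩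
  obtain ⟨B, hB, hBD, hdef⟩ := h𝓕 D hD
  obtain ⟨ψ, hψ⟩ := hdef.image_eval i
  have hψ' : ∀ y : 𝔐 (σ i), (∃ a ∈ B, a i = y) ↔ SatOver ψ (fun _ : Unit => y) := fun y =>
    Set.ext_iff.1 hψ (fun _ => y)
  obtain ⟨a, ha, hax⟩ := (hψ' x).2 (hx ψ (by
    filter_upwards [hB] with a ha
    exact (hψ' _).1 ⟨a, ha, rfl⟩))
  exact ⟨a, hBD ha, hax⟩

/-- Partial types in countably many variables over small sets are realised. -/
theorem IsSaturated.exists_mem_of_filter (hsat : IsSaturated L 𝔐 κ) (hκ : Cardinal.aleph0 ≤ κ)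
    {I : Type v} [Countable I] {σ : I → S} (𝓕 : Filter (Tup 𝔐 σ)) [h𝓕 : 𝓕.NeBot]
    {A : Params 𝔐} (hA : Cardinal.mk A < κ) : ∃ c, ∀ D ∈ 𝓕, DefOver L A D → c ∈ D := by
  classical
  let _ : Encodable I := Encodable.ofCountable I
  -- A state is a proper filter with a basis of sets definable over a small set. Stage `n` fixes the
  -- coordinate with code `n`, if any, at the cost of one new parameter.
  let St := {p : Filter (Tup 𝔐 σ) × Params 𝔐 // p.1.NeBot ∧ Cardinal.mk p.2 < κ ∧
    ∀ D ∈ p.1, ∃ B ∈ p.1, B ⊆ D ∧ DefOver L p.2 B}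
  have hstep : ∀ (p : St) (n : ℕ), ∃ q : St, q.1.1 ≤ p.1.1 ∧
      ∀ i : I, Encodable.encode i = n → ∃ x, {a : Tup 𝔐 σ | a i = x} ∈ q.1.1 := by
    intro p n
    by_cases hn : ∃ i : I, Encodable.encode i = n
    · obtain ⟨i, rfl⟩ := hn
      obtain ⟨⟨𝓖, B⟩, h𝓖, hB, hbasis⟩ := p
      have := h𝓖
      obtain ⟨x, hx⟩ := hsat.exists_eval_eq 𝓖 hB hbasis i
      refine ⟨⟨(𝓖 ⊓ 𝓟 {a | a i = x}, B ∪ {⟨σ i, x⟩}), hx, ?_, ?_⟩, inf_le_left, ?_⟩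
      · refine mk_union_lt hκ hB ?_
        rw [Cardinal.mk_singleton]
        exact Cardinal.one_lt_aleph0.trans_le hκ
      · intro D hD
        obtain ⟨E, hE, hED, hdef⟩ := hbasis _ (Filter.mem_inf_principal'.1 hD)
        refine ⟨E ∩ {a | a i = x}, Filter.inter_mem_inf hE (Filter.mem_principal_self _), ?_,
          (hdef.mono Set.subset_union_left).inter
            (DefOver.eval_eq (Set.mem_union_right _ rfl))⟩
        rintro a ⟨ha, hax⟩
        exact (hED ha).resolve_left fun h => h hax
      · intro j hj
        obtain rfl := Encodable.encode_injective hj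
        exact ⟨x, Filter.mem_inf_of_right (Filter.mem_principal_self _)⟩
    · exact ⟨p, le_rfl, fun i hi => (hn ⟨i, hi⟩).elim⟩
  choose step hle hfix using hstep
  -- The given filter need not have a definable basis, so the construction starts from its part
  -- generated by `A`-definable sets.
  let 𝓖 : Filter (Tup 𝔐 σ) :=
    { sets := {D | ∃ B ∈ 𝓕, B ⊆ D ∧ DefOver L A B}
      univ_sets := ⟨_, Filter.univ_mem, subset_rfl, DefOver.univ⟩
      sets_of_superset := fun ⟨B, hB, hBD, hdef⟩ h => ⟨B, hB, hBD.trans h, hdef⟩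
      inter_sets := fun ⟨B, hB, hBD, hdef⟩ ⟨B', hB', hBD', hdef'⟩ =>
        ⟨B ∩ B', Filter.inter_mem hB hB', Set.inter_subset_inter hBD hBD', hdef.inter hdef'⟩ }
  have h𝓖 : 𝓕 ≤ 𝓖 := fun D ⟨B, hB, hBD, _⟩ => Filter.mem_of_superset hB hBD
  let p₀ : St := ⟨(𝓖, A), h𝓕.mono h𝓖, hA, fun D ⟨B, hB, hBD, hdef⟩ =>
    ⟨B, ⟨B, hB, subset_rfl, hdef⟩, hBD, hdef⟩⟩
  let st : ℕ → St := fun n => Nat.rec p₀ (fun n p => step p n) n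
  have hst : Antitone fun n => (st n).1.1 := antitone_nat_of_succ_le fun n => hle (st n) n
  choose c hc using fun i : I => hfix (st (Encodable.encode i)) (Encodable.encode i) i rfl
  have hc' : ∀ i, {a : Tup 𝔐 σ | a i = c i} ∈ (st (Encodable.encode i + 1)).1.1 := hc
  refine ⟨c, fun D hD hdef => ?_⟩
  obtain ⟨F, hF⟩ := hdef.exists_finset_support
  -- By stage `N` all coordinates in the support of `D` are fixed; the `+ 1` is there because the
  -- coordinate with code `n` is fixed in passing from stage `n` to `n + 1`.
  let N := F.sup fun i => Encodable.encode i + 1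
  have hDN : D ∈ (st N).1.1 := hst (Nat.zero_le N) ⟨D, hD, subset_rfl, hdef⟩
  have hFN : ∀ᶠ a in (st N).1.1, ∀ i ∈ F, a i = c i :=
    (Filter.eventually_all_finset F).2 fun i hi =>
      hst (Finset.le_sup (f := fun i => Encodable.encode i + 1) hi) (hc' i)
  have := (st N).2.1
  obtain ⟨a, haD, haF⟩ := ((show ∀ᶠ a in (st N).1.1, a ∈ D from hDN).and hFN).exists
  exact hF a c haF haD

/-- The restriction to a small set of the global type given by an ultrafilter is realised. -/
theorem IsSaturated.exists_mem_iff (hsat : IsSaturated L 𝔐 κ) (hκ : Cardinal.aleph0 ≤ κ)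
    {I : Type v} [Countable I] {σ : I → S} (r : Ultrafilter (Tup 𝔐 σ))
    {A : Params 𝔐} (hA : Cardinal.mk A < κ) : ∃ c, ∀ D, DefOver L A D → (c ∈ D ↔ D ∈ r) := by
  obtain ⟨c, hc⟩ := hsat.exists_mem_of_filter (L := L) hκ (r : Filter (Tup 𝔐 σ)) hA
  refine ⟨c, fun D hD => ⟨fun h => ?_, fun h => hc D h hD⟩⟩
  by_contra hDr
  exact hc Dᶜ (Ultrafilter.compl_mem_iff_notMem.2 hDr) hD.compl h

/-- Countable tuples with the same type over a small set are conjugate over this set. -/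
theorem IsStronglyHomogeneous.exists_act_eq (hhom : IsStronglyHomogeneous L 𝔐 κ)
    (hκ : Cardinal.aleph0 < κ) {I : Type v} [Countable I] {σ : I → S} {A : Params 𝔐}
    (hA : Cardinal.mk A < κ) {a b : Tup 𝔐 σ} (h : tp L A a = tp L A b) :
    ∃ g ∈ Aut L 𝔐, (∀ x ∈ A, g x.1 x.2 = x.2) ∧ act g a = b := by
  let B : Params 𝔐 := A ∪ a.params
  have hB : Cardinal.mk B < κ := mk_union_lt hκ.le hA
    ((Cardinal.le_aleph0_iff_set_countable.2 a.countable_params).trans_lt hκ)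
  have ht : ∀ x : B, ∃ t : Term L (Sum.elim σ A.sort) (B.sort x),
      t.realize (a.append A.self) = B.self x := by
    rintro ⟨x, hx | ⟨i, rfl⟩⟩
    · exact ⟨Term.var (σ := Sum.elim σ A.sort) (.inr ⟨x, hx⟩), rfl⟩
    · exact ⟨Term.var (σ := Sum.elim σ A.sort) (.inl i), rfl⟩
  choose t ht using ht
  have hself : (fun x => (t x).realize (a.append A.self)) = B.self := funext ht
  let b' : Tup 𝔐 B.sort := fun x => (t x).realize (b.append A.self)
  have hφ : ∀ φ : FormulaOver L A σ, Sat φ (a.append A.self) ↔ Sat φ (b.append A.self) :=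
    Set.ext_iff.1 h
  obtain ⟨g, hg, hgB⟩ := hhom B hB b' fun φ => by
    have := hφ (Formula.subst t φ)
    rwa [Formula.sat_subst, Formula.sat_subst, hself] at this
  -- An element of `B` may be named several times, as a parameter or as coordinates of `a`, and `t`
  -- chooses one name. Equalities between names belong to the type, so `b'` does not depend on the
  -- choice.
  have key : ∀ {s : S} (t₁ t₂ : Term L (Sum.elim σ A.sort) s),
      t₁.realize (a.append A.self) = t₂.realize (a.append A.self) →
      t₁.realize (b.append A.self) = t₂.realize (b.append A.self) := by
    intro s t₁ t₂ h12
    let w : ∀ x : I ⊕ A, Term L (Sum.elim (Sum.elim σ A.sort) Fin.elim0) (Sum.elim σ A.sort x) :=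
      fun x => Term.var (σ := Sum.elim (Sum.elim σ A.sort) Fin.elim0) (.inl x)
    have hw : ∀ c : Tup 𝔐 (Sum.elim σ A.sort),
        Sat (.equal (t₁.subst w) (t₂.subst w) : Formula L (Sum.elim σ A.sort)) c ↔
          t₁.realize c = t₂.realize c := by
      intro c
      rw [Sat, BFormula.realize, Term.realize_subst, Term.realize_subst]
      rfl
    exact (hw _).1 ((hφ _).1 ((hw _).2 h12))
  refine ⟨g, hg, fun x hx => ?_, funext fun i => ?_⟩
  · have h1 := congrFun hgB ⟨x, Or.inl hx⟩
    exact h1.trans (key _ (Term.var (σ := Sum.elim σ A.sort) (.inr ⟨x, hx⟩)) (ht _))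
  · have h1 := congrFun hgB ⟨_, Or.inr ⟨i, rfl⟩⟩
    exact h1.trans (key _ (Term.var (σ := Sum.elim σ A.sort) (.inl i)) (ht _))

/-! ### Elementary substructures -/

/-- Elementarity, for formulas with arbitrarily many variables. -/
theorem Substr.IsElementary.sat_iff {M : Substr L 𝔐} (hM : M.IsElementary) {V : Type v}
    {σ : V → S} (φ : Formula L σ) (a : Tup (fun s => M.carrier s) σ) :
    Sat φ a ↔ Sat φ (fun k => (a k : 𝔐 (σ k))) := by
  obtain ⟨F, hF⟩ := BFormula.exists_finset_support.{u} φ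
  obtain ⟨ψ, hψ⟩ := hF F subset_rfl
  let i : Fin F.card → V := fun k => F.equivFin.symm k
  have ht : ∀ v : F, ∃ t : Term L (fun k => σ (i k)) (σ v),
      ∀ (𝔑 : S → Type u) [Str L 𝔑] (c : Tup 𝔑 σ), t.realize (fun k => c (i k)) = c v := by
    intro v
    obtain ⟨k, rfl⟩ := F.equivFin.symm.surjective v
    exact ⟨Term.var (σ := fun k => σ (i k)) k, fun _ _ _ => rfl⟩
  choose t ht using ht
  have hsub : ∀ (𝔑 : S → Type u) [Str L 𝔑] (c : Tup 𝔑 σ),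
      Sat (Formula.subst t ψ) (fun k => c (i k)) ↔ Sat φ c := by
    intro 𝔑 _ c
    rw [Formula.sat_subst, funext fun v => ht v 𝔑 c]
    exact (hψ 𝔑 c _).symm
  rw [← hsub, hM]
  exact hsub 𝔐 fun k => (a k : 𝔐 (σ k))

/-- A nonempty set which is definable over an elementary substructure meets it. -/
theorem Substr.IsElementary.exists_mem {M : Substr L 𝔐} (hM : M.IsElementary) {V : Type v}
    {σ : V → S} {D : Set (Tup 𝔐 σ)} (hD : DefOver L M.params D) (hne : D.Nonempty) :
    ∃ m ∈ D, ∀ i, m i ∈ M.carrier (σ i) := by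
  obtain ⟨φ, rfl⟩ := hD
  obtain ⟨a, ha⟩ := hne
  -- Projection needs some tuple in `M` for all variables at once; elementarity for the sentence
  -- saying that a sort is empty provides elements in each sort used.
  have hsort : ∀ s, Nonempty (𝔐 s) → Nonempty (M.carrier s) := by
    intro s hs
    have := hM 0 Fin.elim0 (BFormula.neg (.all s .falsum)) (fun k => k.elim0)
    by_contra hne
    refine this.2 (fun h => hs.elim fun x => h x) fun x => hne ⟨x⟩
  have : Nonempty (Tup 𝔐 σ) := ⟨a⟩
  have : Nonempty (Tup (fun s => M.carrier s) σ) :=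
    ⟨fun i => Classical.choice (hsort (σ i) ⟨a i⟩)⟩
  obtain ⟨ψ, hψ⟩ := Formula.exists_projection.{u} φ
  let b : Tup (fun s => M.carrier s) M.params.sort := fun x => ⟨x.1.2, x.2⟩
  obtain ⟨m, hm⟩ := (hψ _ b).1 ((hM.sat_iff ψ b).2 ((hψ 𝔐 _).2 ⟨a, ha⟩))
  refine ⟨fun i => m i, ?_, fun i => (m i).2⟩
  have := (hM.sat_iff φ _).1 hm
  change Sat φ _
  convert this using 1
  funext x
  rcases x with v | x <;> rfl

end Monster

/-! ### Normal forms, coheirs and bounded diameter of types over a model. -/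

section NormalForms

variable {S : Type} {L : Lang S} {𝔐 : S → Type u} [Str L 𝔐] {κ : Cardinal.{u}}
  {I : Type} {σ : I → S} {X : Set (Tup 𝔐 σ)} {E : Tup 𝔐 σ → Tup 𝔐 σ → Prop}
  {Φ : ℕ → Tup 𝔐 σ → Tup 𝔐 σ → Prop}

theorem append_mem_pairs {R : Tup 𝔐 σ → Tup 𝔐 σ → Prop} {a b : Tup 𝔐 σ} :
    a.append b ∈ pairs R ↔ R a b := by
  refine ⟨?_, fun h => ⟨a, b, h, rfl⟩⟩
  rintro ⟨a', b', h, hab⟩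
  obtain rfl : a = a' := funext fun i => congrFun hab (.inl i)
  obtain rfl : b = b' := funext fun i => congrFun hab (.inr i)
  exact h

namespace IsNormalForm

theorem monotone (h : IsNormalForm L Φ E X) {n m : ℕ} (hnm : n ≤ m) {a b : Tup 𝔐 σ}
    (hab : Φ n a b) : Φ m a b := by
  induction hnm with
  | refl => exact hab
  | step _ ih => exact h.mono _ _ _ ih

/-- Since the `Φ n` increase, the balls of `dist` are exactly the `Φ n`; through this the metric
axioms become symmetry and additive transitivity of the partial types. -/
theorem dist_le_iff (h : IsNormalForm L Φ E X) {n : ℕ} {a b : Tup 𝔐 σ} :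
    dist Φ a b ≤ n ↔ Φ n a b := by
  refine ⟨fun hd => ?_, fun hab => iInf₂_le n hab⟩
  by_contra hab
  have : ((n + 1 : ℕ) : ℕ∞) ≤ dist Φ a b := by
    refine le_iInf₂ fun k hk => ?_
    have : n + 1 ≤ k := by
      by_contra hkn
      exact hab (h.monotone (by omega) hk)
    exact_mod_cast this
  have h2 := this.trans hd
  norm_cast at h2
  omega

theorem refl (h : IsNormalForm L Φ E X) (n : ℕ) {a : Tup 𝔐 σ} (ha : a ∈ X) : Φ n a a :=
  h.monotone (Nat.zero_le n) ((h.zero a a).2 ⟨rfl, ha⟩)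

theorem symm (h : IsNormalForm L Φ E X) {n : ℕ} {a b : Tup 𝔐 σ} (hab : Φ n a b) : Φ n b a := by
  obtain ⟨ha, hb⟩ := h.mem n a b hab
  rw [← h.dist_le_iff] at hab ⊢
  rwa [h.dist_symm b hb a ha]

theorem trans (h : IsNormalForm L Φ E X) {n m : ℕ} {a b c : Tup 𝔐 σ} (hab : Φ n a b)
    (hbc : Φ m b c) : Φ (n + m) a c := by
  obtain ⟨ha, hb⟩ := h.mem n a b hab
  obtain ⟨_, hc⟩ := h.mem m b c hbc
  rw [← h.dist_le_iff] at hab hbc ⊢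
  push_cast
  exact (h.dist_triangle a ha b hb c hc).trans (add_le_add hab hbc)

theorem rel (h : IsNormalForm L Φ E X) {n : ℕ} {a b : Tup 𝔐 σ} (hab : Φ n a b) : E a b :=
  (h.equiv a (h.mem n a b hab).1 b (h.mem n a b hab).2).2 ⟨n, hab⟩

theorem act_iff (h : IsNormalForm L Φ E X) {n : ℕ} {g : ∀ s, Equiv.Perm (𝔐 s)} (hg : g ∈ Aut L 𝔐)
    {a b : Tup 𝔐 σ} : Φ n (act g a) (act g b) ↔ Φ n a b := by
  rw [← append_mem_pairs (R := Φ n), ← append_mem_pairs (R := Φ n), ← act_append]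
  have htp : tp L ∅ (act g (a.append b)) = tp L ∅ (a.append b) := tp_act hg (by simp) _
  exact ⟨(h.typeDefinable n).mem_of_tp_eq htp, (h.typeDefinable n).mem_of_tp_eq htp.symm⟩

end IsNormalForm

theorem mk_lt_of_countable (hκ : Cardinal.aleph0 < κ) {A : Params 𝔐} (hA : A.Countable) :
    Cardinal.mk A < κ :=
  (Cardinal.le_aleph0_iff_set_countable.2 hA).trans_lt hκ

/-- A bounded equivalence relation has a small set of representatives of its classes. -/
theorem exists_representatives (hκ : Cardinal.aleph0 < κ) [Countable I]
    (hE_bounded : Cardinal.mk (classes E X) < κ) :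
    ∃ B : Params 𝔐, Cardinal.mk B < κ ∧
      ∀ a ∈ X, ∃ e ∈ X, e.params ⊆ B ∧ ({b | E e b} : Set (Tup 𝔐 σ)) = {b | E a b} := by
  have hrep : ∀ K : classes E X, ∃ e ∈ X, {b | E e b} = K.1 := fun K => K.2
  choose e heX he using hrep
  refine ⟨⋃ K, (e K).params, ?_, fun a ha =>
    ⟨e ⟨_, a, ha, rfl⟩, heX _, Set.subset_iUnion (fun K => (e K).params) _, he _⟩⟩
  refine (Cardinal.mk_iUnion_le _).trans_lt (Cardinal.mul_lt_of_lt hκ.le hE_bounded ?_)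
  exact (ciSup_le' fun K =>
    Cardinal.le_aleph0_iff_set_countable.2 (e K).countable_params).trans_lt hκ

/-- A complete type over a model extends to a global type which is finitely satisfiable in it. -/
theorem exists_coheir {M : Substr L 𝔐} (hM : M.IsElementary) (a : Tup 𝔐 σ) :
    ∃ r : Ultrafilter (Tup 𝔐 σ), {m : Tup 𝔐 σ | ∀ i, m i ∈ M.carrier (σ i)} ∈ r ∧
      ∀ D, DefOver L M.params D → a ∈ D → D ∈ r := by
  let 𝓕 : Filter (Tup 𝔐 σ) :=
    { sets := {D | ∃ B, DefOver L M.params B ∧ a ∈ B ∧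
        {m : Tup 𝔐 σ | ∀ i, m i ∈ M.carrier (σ i)} ∩ B ⊆ D}
      univ_sets := ⟨_, DefOver.univ, trivial, Set.subset_univ _⟩
      sets_of_superset := fun ⟨B, hB, ha, hBD⟩ h => ⟨B, hB, ha, hBD.trans h⟩
      inter_sets := fun ⟨B, hB, ha, hBD⟩ ⟨B', hB', ha', hBD'⟩ =>
        ⟨B ∩ B', hB.inter hB', ⟨ha, ha'⟩, fun m hm =>
          ⟨hBD ⟨hm.1, hm.2.1⟩, hBD' ⟨hm.1, hm.2.2⟩⟩⟩ }
  have h𝓕 : 𝓕.NeBot := by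
    refine Filter.neBot_iff.2 fun hbot => ?_
    obtain ⟨B, hB, ha, hsub⟩ : (∅ : Set (Tup 𝔐 σ)) ∈ 𝓕 := hbot ▸ Filter.mem_bot
    obtain ⟨m, hmB, hm⟩ := hM.exists_mem hB ⟨a, ha⟩
    exact hsub ⟨hm, hmB⟩
  refine ⟨Ultrafilter.of 𝓕, Ultrafilter.of_le 𝓕 ⟨_, DefOver.univ, trivial, Set.inter_subset_left⟩,
    fun D hD ha => Ultrafilter.of_le 𝓕 ⟨D, hD, ha, Set.inter_subset_right⟩⟩

/-- The set of realisations of a complete type over a countable model has finite diameter. -/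
theorem IsNormalForm.exists_forall_tp_eq (hΦ : IsNormalForm L Φ E X) (h𝔐 : IsMonster L 𝔐 κ)
    (hκ : Cardinal.aleph0 < κ) [Countable I] (hX : IsTypeDefinableOver L ∅ X)
    (hE : IsEquivOn E X) (hE_bounded : Cardinal.mk (classes E X) < κ) {M : Substr L 𝔐}
    (hM : M.IsCountableModel) {a : Tup 𝔐 σ} (ha : a ∈ X) :
    ∃ n, ∀ b b', tp L M.params b = tp L M.params a → tp L M.params b' = tp L M.params a →
      Φ n b b' := by
  obtain ⟨r, hrM, hra⟩ := exists_coheir hM.1 a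
  obtain ⟨B₀, hB₀, hrep⟩ := exists_representatives (𝔐 := 𝔐) (σ := σ) hκ hE_bounded
  have hMκ := mk_lt_of_countable hκ hM.2
  have hsmall : ∀ {A : Params 𝔐} (c : Tup 𝔐 σ), Cardinal.mk A < κ →
      Cardinal.mk ↑(A ∪ c.params) < κ := fun c hA =>
    mk_union_lt hκ.le hA (mk_lt_of_countable hκ c.countable_params)
  have hreal : ∀ A : Params 𝔐, Cardinal.mk A < κ → ∃ c : Tup 𝔐 σ, ∀ D, DefOver L A D →
      (c ∈ D ↔ D ∈ r) := fun A hA => h𝔐.saturated.exists_mem_iff hκ.le r hA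
  have htp : ∀ {A : Params 𝔐} {c : Tup 𝔐 σ}, M.params ⊆ A →
      (∀ D, DefOver L A D → (c ∈ D ↔ D ∈ r)) → tp L M.params c = tp L M.params a := by
    intro A c hA hc
    exact (tp_eq_of_forall_imp fun D hD haD => (hc D (hD.mono hA)).2 (hra D hD haD)).symm
  -- Realisations of `r` over a set containing all class representatives lie at the same distance
  -- `n` from the same representative `e`, so two of them are at distance at most `n + n`.
  obtain ⟨c₁, hc₁⟩ := hreal (M.params ∪ B₀) (mk_union_lt hκ.le hMκ hB₀)
  have hc₁X : c₁ ∈ X := hX.mem_of_tp_eq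
    (tp_eq_mono (Set.empty_subset _) (htp Set.subset_union_left hc₁).symm) ha
  obtain ⟨e, heX, heB, hec⟩ := hrep c₁ hc₁X
  obtain ⟨n, hn⟩ := (hΦ.equiv c₁ hc₁X e heX).1 (hec ▸ hE.refl heX : e ∈ {b | E c₁ b})
  obtain ⟨c₂, hc₂⟩ := hreal (M.params ∪ B₀ ∪ c₁.params)
    (hsmall c₁ (mk_union_lt hκ.le hMκ hB₀))
  have hn₂ : Φ n c₂ e := by
    obtain ⟨𝓓, h𝓓, hpairs⟩ := (hΦ.typeDefinable n).exists_family
    rw [← append_mem_pairs (R := Φ n), hpairs] at hn ⊢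
    intro D hD
    have hdef : DefOver L (M.params ∪ B₀) {c : Tup 𝔐 σ | c.append e ∈ D} :=
      (h𝓓 D hD).section_left (Set.empty_subset _) (heB.trans Set.subset_union_right)
    exact (hc₂ _ (hdef.mono Set.subset_union_left)).2 ((hc₁ _ hdef).1 (hn D hD))
  have h12 : Φ (n + n) c₁ c₂ := hΦ.trans hn (hΦ.symm hn₂)
  -- Finite satisfiability in `M` makes `r` invariant over `M`: a condition on `c₁` and `r` is
  -- tested on tuples `m` of `M`, where `c₁` may be replaced by any `b` of the same type over `M`.
  have key : ∀ {A : Params 𝔐} {b c : Tup 𝔐 σ}, M.params ∪ b.params ⊆ A →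
      (∀ D, DefOver L A D → (c ∈ D ↔ D ∈ r)) → tp L M.params b = tp L M.params a →
      Φ (n + n) b c := by
    intro A b c hA hc hb
    obtain ⟨𝓓, h𝓓, hpairs⟩ := (hΦ.typeDefinable (n + n)).exists_family
    rw [← append_mem_pairs (R := Φ (n + n)), hpairs] at h12 ⊢
    intro D hD
    have hdef : DefOver L A {x : Tup 𝔐 σ | b.append x ∈ D} :=
      (h𝓓 D hD).section_right (Set.empty_subset _) (Set.subset_union_right.trans hA)
    have hdef₁ : DefOver L (M.params ∪ B₀ ∪ c₁.params) {x : Tup 𝔐 σ | c₁.append x ∈ D} :=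
      (h𝓓 D hD).section_right (Set.empty_subset _) Set.subset_union_right
    refine (hc _ hdef).2 (Filter.mem_of_superset
      (Filter.inter_mem hrM ((hc₂ _ hdef₁).1 (h12 D hD))) ?_)
    rintro m ⟨hm, hmD⟩
    have hdefm : DefOver L M.params {x : Tup 𝔐 σ | x.append m ∈ D} :=
      (h𝓓 D hD).section_left (Set.empty_subset _) (by rintro _ ⟨i, rfl⟩; exact hm i)
    exact (tp_eq_iff.1 (hb.trans (htp Set.subset_union_left hc₁).symm) _ hdefm).2 hmD
  -- Both points are compared with one realisation of `r` over `M`, `b` and `b'`.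
  refine ⟨n + n + (n + n), fun b b' hb hb' => ?_⟩
  obtain ⟨c, hc⟩ := hreal (M.params ∪ b.params ∪ b'.params) (hsmall b' (hsmall b hMκ))
  refine hΦ.trans (key Set.subset_union_left hc hb) (hΦ.symm (key ?_ hc hb'))
  exact Set.union_subset (Set.subset_union_left.trans Set.subset_union_left)
    Set.subset_union_right

/-- If two global types given by ultrafilters cannot be separated by formulas over `A`, with respect
to a type-definable relation, then their restrictions to `A` have related realisations. -/
theorem exists_rel_of_not_separated (hsat : IsSaturated L 𝔐 κ) (hκ : Cardinal.aleph0 ≤ κ)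
    [Countable I] {R : Tup 𝔐 σ → Tup 𝔐 σ → Prop} (hR : IsTypeDefinableOver L ∅ (pairs R))
    {A : Params 𝔐} (hA : Cardinal.mk A < κ) (r r' : Ultrafilter (Tup 𝔐 σ))
    (h : ∀ D D', DefOver L A D → DefOver L A D' → D ∈ r → D' ∈ r' → ∃ a ∈ D, ∃ b ∈ D', R a b) :
    ∃ b b', R b b' ∧ ∀ D, DefOver L A D → (D ∈ r → b ∈ D) ∧ (D ∈ r' → b' ∈ D) := by
  -- This filter expresses the partial type asserting `R` between a realisation of `r` and one of
  -- `r'`, both over `A`; the hypothesis `h` is its finite consistency.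
  let 𝓕 : Filter (Tup 𝔐 (Sum.elim σ σ)) :=
    { sets := {T | ∃ D D', DefOver L A D ∧ DefOver L A D' ∧ D ∈ r ∧ D' ∈ r' ∧
        ∀ a ∈ D, ∀ b ∈ D', R a b → a.append b ∈ T}
      univ_sets := ⟨_, _, DefOver.univ, DefOver.univ, Filter.univ_mem, Filter.univ_mem,
        fun _ _ _ _ _ => trivial⟩
      sets_of_superset := fun ⟨D, D', h1, h2, h3, h4, h5⟩ hT =>
        ⟨D, D', h1, h2, h3, h4, fun a ha b hb hab => hT (h5 a ha b hb hab)⟩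
      inter_sets := fun ⟨D, D', h1, h2, h3, h4, h5⟩ ⟨D₁, D₁', k1, k2, k3, k4, k5⟩ =>
        ⟨D ∩ D₁, D' ∩ D₁', h1.inter k1, h2.inter k2, Filter.inter_mem h3 k3,
          Filter.inter_mem h4 k4, fun a ha b hb hab =>
            ⟨h5 a ha.1 b hb.1 hab, k5 a ha.2 b hb.2 hab⟩⟩ }
  have h𝓕 : 𝓕.NeBot := by
    refine Filter.neBot_iff.2 fun hbot => ?_
    obtain ⟨D, D', h1, h2, h3, h4, h5⟩ : ∅ ∈ 𝓕 := hbot ▸ Filter.mem_bot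
    obtain ⟨a, ha, b, hb, hab⟩ := h D D' h1 h2 h3 h4
    exact h5 a ha b hb hab
  obtain ⟨c, hc⟩ := hsat.exists_mem_of_filter (L := L) hκ 𝓕 hA
  have hcR : c ∈ pairs R := by
    obtain ⟨𝓓, h𝓓, hpairs⟩ := hR.exists_family
    rw [hpairs]
    intro T hT
    refine hc T ⟨_, _, DefOver.univ, DefOver.univ, Filter.univ_mem, Filter.univ_mem,
      fun a _ b _ hab => ?_⟩ ((h𝓓 T hT).mono (Set.empty_subset _))
    exact (hpairs ▸ append_mem_pairs.2 hab : a.append b ∈ ⋂₀ 𝓓) T hT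
  obtain ⟨b, b', hbb', rfl⟩ := hcR
  refine ⟨b, b', hbb', fun D hD => ⟨fun hDr => ?_, fun hDr => ?_⟩⟩
  · exact hc _ ⟨D, _, hD, DefOver.univ, hDr, Filter.univ_mem, fun a ha _ _ _ => ha⟩
      hD.inl_preimage
  · exact hc _ ⟨_, D, DefOver.univ, hD, Filter.univ_mem, hDr, fun _ _ a ha _ => ha⟩
      hD.inr_preimage

end NormalForms

/-! ### Almost periodic ultrafilters. -/

/-- A group acting on a set has an almost periodic ultrafilter on every invariant set. -/
theorem exists_almostPeriodic {G : Type v} {α : Type w} [Group G] (ρ : G → α → α)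
    (h1 : ∀ a, ρ 1 a = a) (hmul : ∀ g h a, ρ (g * h) a = ρ g (ρ h a)) {C : Set α}
    (hC : C.Nonempty) (hρC : ∀ g, Set.MapsTo (ρ g) C C) :
    ∃ r : Ultrafilter α, C ∈ r ∧ ∀ U ∈ r, ∃ F : Finset G, ∀ g, ∃ f ∈ F,
      {a | ρ f (ρ g a) ∈ U} ∈ r := by
  classical
  -- Invariant proper filters correspond to nonempty closed invariant sets of ultrafilters. The
  -- order is reversed so that a Zorn-maximal element is a finest such filter, that is, a minimal
  -- subflow; any ultrafilter refining it works.
  let 𝒮 : Set (Filter α)ᵒᵈ := {𝓕 | (OrderDual.ofDual 𝓕).NeBot ∧ C ∈ OrderDual.ofDual 𝓕 ∧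
    ∀ g, ∀ D ∈ OrderDual.ofDual 𝓕, ρ g ⁻¹' D ∈ OrderDual.ofDual 𝓕}
  obtain ⟨m, -, hm⟩ := zorn_le_nonempty₀ 𝒮 (by
    intro c hc hchain y hy
    have hdir : DirectedOn (· ≥ ·) (OrderDual.ofDual '' c) := by
      rintro _ ⟨a, ha, rfl⟩ _ ⟨b, hb, rfl⟩
      rcases hchain.total ha hb with h | h
      · exact ⟨_, ⟨b, hb, rfl⟩, h, le_rfl⟩
      · exact ⟨_, ⟨a, ha, rfl⟩, le_rfl, h⟩
    have hne : (OrderDual.ofDual '' c).Nonempty := ⟨_, y, hy, rfl⟩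
    have hmem : ∀ D, D ∈ sInf (OrderDual.ofDual '' c) ↔ ∃ a ∈ c, D ∈ OrderDual.ofDual a := by
      intro D
      rw [sInf_eq_iInf, Filter.mem_biInf_of_directed hdir hne, Set.exists_mem_image]
    refine ⟨OrderDual.toDual (sInf (OrderDual.ofDual '' c)), ⟨?_, ?_, ?_⟩, ?_⟩
    · refine Filter.sInf_neBot_of_directed' hne hdir ?_
      rintro ⟨a, ha, hbot⟩
      exact (hc ha).1.ne hbot
    · exact (hmem _).2 ⟨y, hy, (hc hy).2.1⟩
    · intro g D hD
      obtain ⟨a, ha, hDa⟩ := (hmem _).1 hD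
      exact (hmem _).2 ⟨a, ha, (hc ha).2.2 g D hDa⟩
    · intro a ha
      change sInf (OrderDual.ofDual '' c) ≤ OrderDual.ofDual a
      exact sInf_le ⟨a, ha, rfl⟩)
    (OrderDual.toDual (Filter.principal C))
    ⟨Filter.principal_neBot_iff.2 hC, Filter.mem_principal_self C, fun g D hD a ha =>
      hD (hρC g ha)⟩
  obtain ⟨⟨hne, hCm, hinv⟩, hmax⟩ := hm
  set 𝓕 : Filter α := OrderDual.ofDual m
  refine ⟨Ultrafilter.of 𝓕, Ultrafilter.of_le 𝓕 hCm, fun U hU => ?_⟩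
  by_contra hcon
  push Not at hcon
  have hfin : ∀ F : Finset G, (⋃ f ∈ F, ρ f ⁻¹' U) ∉ 𝓕 := by
    intro F hF
    obtain ⟨g, hg⟩ := hcon F
    have h2 : ρ g ⁻¹' (⋃ f ∈ F, ρ f ⁻¹' U) ∈ Ultrafilter.of 𝓕 :=
      Ultrafilter.of_le 𝓕 (hinv g _ hF)
    rw [Set.preimage_iUnion₂] at h2
    obtain ⟨f, hf, h3⟩ := (Ultrafilter.finite_biUnion_mem_iff F.finite_toSet).1 h2
    exact hg f hf h3
  -- Adding the complements of all translates of `U` keeps the filter invariant, and proper by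
  -- `hfin`. Minimality then puts `Uᶜ` into `𝓕`, although `U` belongs to an ultrafilter refining
  -- `𝓕`.
  let 𝓖 : Filter α :=
    { sets := {D | ∃ F : Finset G, D ∪ ⋃ f ∈ F, ρ f ⁻¹' U ∈ 𝓕}
      univ_sets := ⟨∅, by simp⟩
      sets_of_superset := fun ⟨F, hF⟩ h =>
        ⟨F, Filter.mem_of_superset hF (Set.union_subset_union_left _ h)⟩
      inter_sets := by
        rintro D D' ⟨F, hF⟩ ⟨F', hF'⟩
        refine ⟨F ∪ F', Filter.mem_of_superset (Filter.inter_mem hF hF') ?_⟩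
        intro a ha
        simp only [Set.mem_inter_iff, Set.mem_union, Set.mem_iUnion, Finset.mem_union] at ha ⊢
        grind }
  have h𝓖 : OrderDual.toDual 𝓖 ∈ 𝒮 := by
    refine ⟨Filter.neBot_iff.2 fun hbot => ?_, ⟨∅, by simpa using hCm⟩, ?_⟩
    · obtain ⟨F, hF⟩ : ∅ ∈ 𝓖 := (show 𝓖 = ⊥ from hbot) ▸ Filter.mem_bot
      exact hfin F (by simpa using hF)
    · rintro g D ⟨F, hF⟩
      refine ⟨F.image (· * g), Filter.mem_of_superset (hinv g _ hF) ?_⟩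
      intro a ha
      simp only [Set.mem_preimage, Set.mem_union, Set.mem_iUnion, Finset.mem_image] at ha ⊢
      rcases ha with ha | ⟨f, hf, ha⟩
      · exact Or.inl ha
      · exact Or.inr ⟨f * g, ⟨f, hf, rfl⟩, by rwa [hmul]⟩
  have hle : 𝓖 ≤ 𝓕 := fun D hD => ⟨∅, by simpa using hD⟩
  have hU' : Uᶜ ∈ 𝓖 := by
    refine ⟨{1}, Filter.univ_mem' fun a => ?_⟩
    by_cases ha : a ∈ U
    · exact Or.inr (by simpa [h1] using ha)
    · exact Or.inl ha
  have : Uᶜ ∈ 𝓕 := hmax h𝓖 hle hU'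
  exact Ultrafilter.compl_mem_iff_notMem.1 (Ultrafilter.of_le 𝓕 this) hU

/-! ### Non-smoothness of eventual equality by the zero-one law. -/

section EventualEquality

open MeasureTheory ProbabilityTheory Filter

/-- The fair coin-tossing measure on `2^ℕ`. -/
noncomputable def coinMeasure : Measure (ℕ → Bool) :=
  Measure.infinitePi fun _ => (PMF.uniformOfFintype Bool).toMeasure

instance : IsProbabilityMeasure coinMeasure := by
  unfold coinMeasure; infer_instance

theorem coinMeasure_singleton (x : ℕ → Bool) : coinMeasure {x} = 0 := by
  have h : ∀ n : ℕ, coinMeasure {x} ≤ 2⁻¹ ^ n := by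
    intro n
    calc coinMeasure {x} ≤ coinMeasure ((Finset.range n : Set ℕ).pi fun i => {x i}) :=
          measure_mono (by rintro y rfl i _; rfl)
      _ = ∏ i ∈ Finset.range n, (PMF.uniformOfFintype Bool).toMeasure {x i} :=
          Measure.infinitePi_pi _ fun _ _ => measurableSet_singleton _
      _ = 2⁻¹ ^ n := by
          rw [Finset.prod_eq_pow_card (b := 2⁻¹), Finset.card_range]
          intro i _
          rw [PMF.toMeasure_apply_singleton _ _ (measurableSet_singleton _)]
          simp
  exact le_antisymm (ge_of_tendsto'
    (ENNReal.tendsto_pow_atTop_nhds_zero_of_lt_one (by simp)) h) zero_le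

/-- A set which is invariant under eventual equality is null or conull. -/
theorem coinMeasure_zero_or_one {B : Set (ℕ → Bool)} (hB : MeasurableSet B)
    (hinv : ∀ x y, E₀ x y → x ∈ B → y ∈ B) : coinMeasure B = 0 ∨ coinMeasure B = 1 := by
  have hind : iIndepFun (fun (i : ℕ) (x : ℕ → Bool) => x i) coinMeasure :=
    iIndepFun_infinitePi (X := fun _ b => b) fun _ => measurable_id
  refine measure_zero_or_one_of_measurableSet_limsup_atTop
    (fun n => (measurable_pi_apply n).comap_le) hind ?_
  rw [Filter.limsup_eq_iInf_iSup_of_nat]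
  rw [MeasurableSpace.measurableSet_iInf]
  intro n
  let m : MeasurableSpace (ℕ → Bool) :=
    ⨆ i, ⨆ (_ : i ≥ n), MeasurableSpace.comap (fun x : ℕ → Bool => x i) inferInstance
  -- Erasing the first `n` coordinates does not change membership in `B`, so `B` is measurable with
  -- respect to the coordinates from `n` on: it is a tail event.
  let t : (ℕ → Bool) → (ℕ → Bool) := fun x i => if i < n then false else x i
  have ht : @Measurable _ _ m MeasurableSpace.pi t := by
    refine @measurable_pi_lambda _ _ _ m _ t fun i => ?_
    by_cases hi : i < n
    · simp only [t, hi, if_true]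
      exact @measurable_const _ _ _ m _
    · simp only [t, hi, if_false]
      exact Measurable.mono (comap_measurable _)
        (le_iSup₂_of_le i (not_lt.1 hi) le_rfl) le_rfl
  have hpre : t ⁻¹' B = B := by
    ext x
    have h1 : E₀ x (t x) := ⟨n, fun i hi => by simp [t, not_lt.2 hi]⟩
    have h2 : E₀ (t x) x := ⟨n, fun i hi => by simp [t, not_lt.2 hi]⟩
    exact ⟨hinv _ _ h2, hinv _ _ h1⟩
  have := ht hB
  rwa [hpre] at this

theorem countable_setOf_E₀ (x : ℕ → Bool) : {y | E₀ x y}.Countable := by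
  have : {y | E₀ x y} ⊆ ⋃ n : ℕ, Set.range fun (s : Fin n → Bool) (i : ℕ) =>
      if h : i < n then s ⟨i, h⟩ else x i := by
    rintro y ⟨n, hn⟩
    refine Set.mem_iUnion.2 ⟨n, fun i => y i, funext fun i => ?_⟩
    by_cases h : i < n
    · simp [h]
    · simp [h, hn i (not_lt.1 h)]
  exact (Set.countable_iUnion fun n => Set.countable_range _).mono this

/-- Eventual equality of binary sequences is not smooth. -/
theorem not_isSmooth_E₀ : ¬ IsSmooth E₀ := by
  rintro ⟨Z, _, _, f, hf, hE⟩
  let _ : MeasurableSpace Z := borel Z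
  have : BorelSpace Z := ⟨rfl⟩
  have hf' : Measurable f := by
    rw [← BorelSpace.measurable_eq (α := ℕ → Bool)] at hf
    exact hf
  have : Nonempty Z := ⟨f fun _ => false⟩
  -- Preimages of Borel sets are invariant, hence null or conull, so the reduction is almost
  -- everywhere constant. A single class would then be conull, yet classes are countable and points
  -- are null.
  obtain ⟨c, hc⟩ := exists_eventuallyEq_const_of_forall_separating (l := ae coinMeasure) (f := f)
    MeasurableSet (fun U hU => by
      rcases coinMeasure_zero_or_one (hf' hU) (fun x y h hx => by
        have : f x = f y := (hE x y).1 h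
        simpa [← this] using hx) with h | h
      · right
        exact measure_eq_zero_iff_ae_notMem.1 h
      · left
        exact (mem_ae_iff_prob_eq_one (hf' hU)).2 h)
  obtain ⟨x, hx⟩ := hc.exists
  have hnull : coinMeasure {y | E₀ x y} = 0 :=
    by
    have : NullSingletonClass coinMeasure := ⟨coinMeasure_singleton⟩
    exact (countable_setOf_E₀ x).measure_zero _
  have : ∀ᵐ y ∂coinMeasure, y ∈ {y | E₀ x y} := by
    filter_upwards [hc] with y hy
    exact (hE x y).2 (hx.trans hy.symm)
  have := (measure_eq_zero_iff_ae_notMem.1 hnull).and this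
  obtain ⟨y, h1, h2⟩ := this.exists
  exact h1 h2

end EventualEquality

/-! ### Separating translates of an almost periodic type; the Cantor scheme. -/

section Embedding

variable {S : Type} {L : Lang S} {𝔐 : S → Type u} [Str L 𝔐] {κ : Cardinal.{u}}
  {I : Type} {σ : I → S} {X : Set (Tup 𝔐 σ)} {E : Tup 𝔐 σ → Tup 𝔐 σ → Prop}
  {Φ : ℕ → Tup 𝔐 σ → Tup 𝔐 σ → Prop}

/-- For an almost periodic global type `r`, some translate of `r` by an element `γ` which moves
`r` only within `U` is arbitrarily far from `r`, even up to finitely many translations; the distance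
is witnessed by formulas over a given model. -/
theorem exists_separating [Countable I] (h𝔐 : IsMonster L 𝔐 κ) (hκ : Cardinal.aleph0 < κ)
    (hΦ : IsNormalForm L Φ E X) {M : Substr L 𝔐} (hM : M.IsCountableModel)
    (hfin : ∀ a ∈ X, ∃ n, ∀ b b', tp L M.params b = tp L M.params a →
      tp L M.params b' = tp L M.params a → Φ n b b')
    {Γ : Subgroup (∀ s, Equiv.Perm (𝔐 s))} (hΓ : Γ ≤ Aut L 𝔐) {Z : Set (Tup 𝔐 σ)}
    (hZX : Z ⊆ X) (hΓE : ∀ a ∈ Z, ∀ g ∈ Γ, E a (act g a))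
    (hunb : ∀ a ∈ Z, ∀ N, ∃ g ∈ Γ, ¬ Φ N a (act g a)) {r : Ultrafilter (Tup 𝔐 σ)}
    (hrZ : ∀ A : Params 𝔐, ∀ c, (∀ D, DefOver L A D → (c ∈ D ↔ D ∈ r)) → c ∈ Z)
    (hr : ∀ U ∈ r, ∃ F : Finset Γ, ∀ g : Γ, ∃ f ∈ F, {a | act f (act g a) ∈ U} ∈ r)
    (H : Finset Γ) (N : ℕ) {U : Set (Tup 𝔐 σ)} (hU : U ∈ r) :
    ∃ γ : Γ, {a | act γ a ∈ U} ∈ r ∧ ∀ s ∈ H, ∀ t ∈ H, ∃ D D', DefOver L M.params D ∧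
      DefOver L M.params D' ∧ {a | act s a ∈ D} ∈ r ∧ {a | act (t * γ : Γ) a ∈ D'} ∈ r ∧
      ∀ a ∈ D, ∀ b ∈ D', ¬ Φ N a b := by
  classical
  by_contra hcon
  push Not at hcon
  have hMc := hM.2
  have himage : ∀ g : Γ, (M.params.image (g⁻¹ : Γ)).Countable := fun g => hMc.image _
  -- The sets `s⁻¹ M` are included so that `act s b₀` realises the translate of `r` by `s` over `M`,
  -- for every `s ∈ H`.
  let A₀ : Params 𝔐 := M.params ∪ ⋃ s ∈ H, M.params.image (s⁻¹ : Γ)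
  have hA₀ : A₀.Countable := hMc.union (H.countable_toSet.biUnion fun s _ => himage s)
  obtain ⟨b₀, hb₀⟩ := h𝔐.saturated.exists_mem_iff hκ.le r (mk_lt_of_countable hκ hA₀)
  have hb₀Z := hrZ A₀ b₀ hb₀
  have hs₀X : ∀ s : Γ, act s b₀ ∈ X := fun s =>
    (hΦ.mem 0 _ _ ((hΦ.act_iff (hΓ s.2)).2 (hΦ.refl 0 (hZX hb₀Z)))).1
  choose e he using fun s : Γ => hfin (act s b₀) (hs₀X s)
  obtain ⟨e', he'⟩ := hfin b₀ (hZX hb₀Z)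
  choose k hk using fun g : Γ => (hΦ.equiv b₀ (hZX hb₀Z) _ (hs₀X g)).1 (hΓE b₀ hb₀Z g g.2)
  obtain ⟨F, hF⟩ := hr U hU
  -- This bounds the path from `b₀` to `(t f)⁻¹ s b₀`, then, after translation by `t f`, from `s b₀`
  -- across its type over `M`, one `Φ N` step, and across the translated type of `b₀` over `M`. It
  -- is fixed before `g`, as it depends only on `F` and `H`.
  let K : ℕ := (F ×ˢ H ×ˢ H).sup fun q => k ((q.2.2 * q.1)⁻¹ * q.2.1) + (e q.2.1 + N + e')
  obtain ⟨g₀, hg₀, hgK⟩ := hunb b₀ hb₀Z K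
  let g : Γ := ⟨g₀, hg₀⟩
  obtain ⟨f, hf, hfg⟩ := hF g
  obtain ⟨s, hs, t, ht, hst⟩ := hcon (f * g) hfg
  refine hgK (hΦ.monotone (Finset.le_sup
    (f := fun q : Γ × Γ × Γ => k ((q.2.2 * q.1)⁻¹ * q.2.1) + (e q.2.1 + N + e'))
    (Finset.mk_mem_product hf (Finset.mk_mem_product hs ht))) ?_)
  refine hΦ.trans (hk _) ?_
  obtain ⟨b₁, b₂, hb₁₂, hb⟩ := exists_rel_of_not_separated h𝔐.saturated hκ.le
    (hΦ.typeDefinable N) (mk_lt_of_countable hκ hMc) (r.map (act s))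
    (r.map (act (t * (f * g) : Γ))) hst
  set q : Γ := t * (f * g) with hq
  -- A second realisation is needed: `q` involves `g`, which was chosen after `b₀`, so `b₀` need not
  -- realise `r` over `q⁻¹ M`. Both have the same type over `M`, whence the term `e'`.
  obtain ⟨b, hbr⟩ := h𝔐.saturated.exists_mem_iff hκ.le r
    (mk_lt_of_countable hκ (hMc.union (himage q)))
  have htp₂ : tp L M.params b₂ = tp L M.params (act q b) :=
    (tp_eq_of_forall_imp fun D hD hbD => (hb D hD).2
      ((hbr _ ((hD.preimage_act (hΓ q.2)).mono Set.subset_union_right)).1 hbD)).symm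
  have htp₁ : tp L M.params b₁ = tp L M.params (act s b₀) :=
    (tp_eq_of_forall_imp fun D hD hbD => (hb D hD).1
      ((hb₀ _ ((hD.preimage_act (hΓ s.2)).mono (Set.subset_union_of_subset_right
        (Set.subset_biUnion_of_mem (u := fun s : Γ => M.params.image (s⁻¹ : Γ)) hs) _))).1
          hbD)).symm
  have htp : tp L M.params b = tp L M.params b₀ :=
    tp_eq_iff.2 fun D hD => (hbr D (hD.mono Set.subset_union_left)).trans
      (hb₀ D (hD.mono Set.subset_union_left)).symm
  obtain ⟨j, hj, hjM, hjb⟩ := h𝔐.homogeneous.exists_act_eq hκ (mk_lt_of_countable hκ hMc) htp₂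
  have h1 : Φ (e s) (act s b₀) (act j b₁) := he s _ _ rfl ((tp_act hj hjM b₁).trans htp₁)
  have h2 : Φ N (act j b₁) (act q b) := hjb ▸ (hΦ.act_iff hj).2 hb₁₂
  have h3 : Φ e' (act q b) (act q b₀) := (hΦ.act_iff (hΓ q.2)).2 (he' b b₀ htp rfl)
  have h4 := (hΦ.act_iff (hΓ ((t * f)⁻¹ : Γ).2)).2 (hΦ.trans (hΦ.trans h1 h2) h3)
  rw [← act_mul, ← act_mul, ← Subgroup.coe_mul, ← Subgroup.coe_mul] at h4
  have hqg : (t * f)⁻¹ * q = g := by rw [hq]; group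
  rw [hqg] at h4
  exact h4

/-- The sets of a filter which contain a set of the filter definable over a countable set. -/
def countablyDefinable (L : Lang S) [Str L 𝔐] (r : Filter (Tup 𝔐 σ)) : Filter (Tup 𝔐 σ) where
  sets := {T | ∃ V ∈ r, (∃ A : Params 𝔐, A.Countable ∧ DefOver L A V) ∧ V ⊆ T}
  univ_sets := ⟨_, Filter.univ_mem, ⟨∅, Set.countable_empty, DefOver.univ⟩, subset_rfl⟩
  sets_of_superset := fun ⟨V, hV, hdef, hVT⟩ h => ⟨V, hV, hdef, hVT.trans h⟩
  inter_sets := fun ⟨V, hV, ⟨A, hA, hVA⟩, hVT⟩ ⟨V', hV', ⟨A', hA', hVA'⟩, hVT'⟩ =>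
    ⟨V ∩ V', Filter.inter_mem hV hV', ⟨A ∪ A', hA.union hA',
      (hVA.mono Set.subset_union_left).inter (hVA'.mono Set.subset_union_right)⟩,
      Set.inter_subset_inter hVT hVT'⟩

theorem preimage_act_mem_countablyDefinable {r : Filter (Tup 𝔐 σ)} {A : Params 𝔐}
    (hA : A.Countable) {D : Set (Tup 𝔐 σ)} (hD : DefOver L A D) {g : ∀ s, Equiv.Perm (𝔐 s)}
    (hg : g ∈ Aut L 𝔐) (h : {a | act g a ∈ D} ∈ r) :
    {a | act g a ∈ D} ∈ countablyDefinable L r :=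
  ⟨_, h, ⟨_, hA.image _, hD.preimage_act hg⟩, subset_rfl⟩

/-- One step of the construction of the Cantor scheme: `V` is a neighbourhood of `r` inside `U` whose
translates by `H` are separated from the translates of `γ V`, and whose translates by `H ∪ H γ`
decide the formula defining `D₀`. -/
theorem exists_scheme_step {M : Substr L 𝔐} (hM : M.IsCountableModel)
    {Γ : Subgroup (∀ s, Equiv.Perm (𝔐 s))} (hΓ : Γ ≤ Aut L 𝔐) {r : Ultrafilter (Tup 𝔐 σ)}
    {R : Tup 𝔐 σ → Tup 𝔐 σ → Prop} {H : Finset Γ}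
    {U : Set (Tup 𝔐 σ)} (hU : U ∈ r) (hUdef : ∃ A : Params 𝔐, A.Countable ∧ DefOver L A U)
    (hsep : ∃ γ : Γ, {a | act γ a ∈ U} ∈ r ∧ ∀ s ∈ H, ∀ t ∈ H, ∃ D D', DefOver L M.params D ∧
      DefOver L M.params D' ∧ {a | act s a ∈ D} ∈ r ∧ {a | act (t * γ : Γ) a ∈ D'} ∈ r ∧
      ∀ a ∈ D, ∀ b ∈ D', ¬ R a b)
    {D₀ : Set (Tup 𝔐 σ)} (hD₀ : DefOver L M.params D₀) :
    ∃ (γ : Γ) (H' : Finset Γ) (V : Set (Tup 𝔐 σ)),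
      (V ∈ r ∧ ∃ A : Params 𝔐, A.Countable ∧ DefOver L A V) ∧ V ⊆ U ∧ (∀ a ∈ V, act γ a ∈ U) ∧
      (∀ s ∈ H, s ∈ H' ∧ s * γ ∈ H') ∧
      (∀ s ∈ H, ∀ t ∈ H, ∃ D D', DefOver L M.params D ∧ DefOver L M.params D' ∧
        (∀ a ∈ V, act s a ∈ D ∧ act (t * γ : Γ) a ∈ D') ∧ ∀ a ∈ D, ∀ b ∈ D', ¬ R a b) ∧
      ∀ s ∈ H', (∀ a ∈ V, act s a ∈ D₀) ∨ ∀ a ∈ V, act s a ∉ D₀ := by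
  classical
  obtain ⟨γ, hγU, hsep⟩ := hsep
  obtain ⟨A, hA, hUA⟩ := hUdef
  -- All requirements on `V` are imposed along this filter, so that their conjunction is still
  -- realised by a countably definable member of `r`.
  let 𝓡 := countablyDefinable L (r : Filter (Tup 𝔐 σ))
  let H' : Finset Γ := H ∪ H.image (· * γ)
  have h1 : ∀ᶠ a in 𝓡, a ∈ U := ⟨U, hU, ⟨A, hA, hUA⟩, subset_rfl⟩
  have h2 : ∀ᶠ a in 𝓡, act γ a ∈ U :=
    preimage_act_mem_countablyDefinable hA hUA (hΓ γ.2) hγU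
  have h3 : ∀ s : H, ∀ t : H, ∃ D D', DefOver L M.params D ∧ DefOver L M.params D' ∧
      (∀ᶠ a in 𝓡, act s.1 a ∈ D ∧ act (t * γ : Γ) a ∈ D') ∧ ∀ a ∈ D, ∀ b ∈ D', ¬ R a b := by
    intro s t
    obtain ⟨D, D', hD, hD', hs, ht, hR⟩ := hsep s s.2 t t.2
    exact ⟨D, D', hD, hD', Filter.Eventually.and
      (preimage_act_mem_countablyDefinable hM.2 hD (hΓ s.1.2) hs)
      (preimage_act_mem_countablyDefinable hM.2 hD' (hΓ (t * γ : Γ).2) ht), hR⟩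
  choose D D' hD hD' hDD' hR using h3
  have h4 : ∀ s : Γ, ∃ T : Set (Tup 𝔐 σ), (∀ᶠ a in 𝓡, act s a ∈ T) ∧ (T = D₀ ∨ T = D₀ᶜ) := by
    intro s
    by_cases hs : {a | act s a ∈ D₀} ∈ r
    · exact ⟨D₀, preimage_act_mem_countablyDefinable hM.2 hD₀ (hΓ s.2) hs, Or.inl rfl⟩
    · exact ⟨D₀ᶜ, preimage_act_mem_countablyDefinable hM.2 hD₀.compl (hΓ s.2)
        (Ultrafilter.compl_mem_iff_notMem.2 hs), Or.inr rfl⟩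
  choose T hT hTD using h4
  obtain ⟨V, hV, hVdef, hVT⟩ : ∀ᶠ a in 𝓡, a ∈ U ∧ act γ a ∈ U ∧
      (∀ s t : H, act s.1 a ∈ D s t ∧ act (t * γ : Γ) a ∈ D' s t) ∧ ∀ s ∈ H', act s a ∈ T s :=
    h1.and (h2.and ((Filter.eventually_all.2 fun s => Filter.eventually_all.2 fun t =>
      hDD' s t).and ((Filter.eventually_all_finset H').2 fun s _ => hT s)))
  refine ⟨γ, H', V, ⟨hV, hVdef⟩, fun a ha => (hVT ha).1, fun a ha => (hVT ha).2.1,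
    fun s hs => ⟨Finset.mem_union_left _ hs,
      Finset.mem_union_right _ (Finset.mem_image_of_mem _ hs)⟩,
    fun s hs t ht => ⟨D ⟨s, hs⟩ ⟨t, ht⟩, D' ⟨s, hs⟩ ⟨t, ht⟩, hD _ _, hD' _ _,
      fun a ha => (hVT ha).2.2.1 _ _, hR _ _⟩, fun s hs => ?_⟩
  rcases hTD s with h | h
  · exact Or.inl fun a ha => h ▸ (hVT ha).2.2.2 s hs
  · exact Or.inr fun a ha => (h ▸ (hVT ha).2.2.2 s hs : act s a ∈ D₀ᶜ)

/-- The products `γ 0 ^ x 0 * ⋯ * γ (n - 1) ^ x (n - 1)`. -/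
def schemeProd {G : Type v} [Group G] (γ : ℕ → G) : ℕ → (ℕ → Bool) → G
  | 0, _ => 1
  | n + 1, x => schemeProd γ n x * if x n then γ n else 1

theorem schemeProd_congr {G : Type v} [Group G] (γ : ℕ → G) {n : ℕ} {x y : ℕ → Bool}
    (h : ∀ i < n, x i = y i) : schemeProd γ n x = schemeProd γ n y := by
  induction n with
  | zero => rfl
  | succ n ih =>
    rw [schemeProd, schemeProd, ih fun i hi => h i (by omega), h n (by omega)]

/-- Later factors are appended on the right, so beyond `N` the two products grow by the same factors
and their quotient on the left stays constant. -/
theorem schemeProd_mul_inv {G : Type v} [Group G] (γ : ℕ → G) {N : ℕ} {x y : ℕ → Bool}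
    (h : ∀ i ≥ N, x i = y i) {n : ℕ} (hn : N ≤ n) :
    schemeProd γ n y = schemeProd γ N y * (schemeProd γ N x)⁻¹ * schemeProd γ n x := by
  induction n, hn using Nat.le_induction with
  | base => group
  | succ n hn ih => rw [schemeProd, schemeProd, ih, h n hn, mul_assoc, mul_assoc]

/-- A Cantor scheme of translates of neighbourhoods of an almost periodic type. -/
theorem exists_scheme [Countable S] [Countable L.Fun] [Countable L.Rel] [Countable I]
    {M : Substr L 𝔐} (hM : M.IsCountableModel)
    {Γ : Subgroup (∀ s, Equiv.Perm (𝔐 s))} (hΓ : Γ ≤ Aut L 𝔐) {r : Ultrafilter (Tup 𝔐 σ)}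
    (hsep : ∀ (H : Finset Γ) (N : ℕ), ∀ U ∈ r,
      ∃ γ : Γ, {a | act γ a ∈ U} ∈ r ∧ ∀ s ∈ H, ∀ t ∈ H, ∃ D D', DefOver L M.params D ∧
        DefOver L M.params D' ∧ {a | act s a ∈ D} ∈ r ∧ {a | act (t * γ : Γ) a ∈ D'} ∈ r ∧
        ∀ a ∈ D, ∀ b ∈ D', ¬ Φ N a b) :
    ∃ (γ : ℕ → Γ) (W : ℕ → (ℕ → Bool) → Set (Tup 𝔐 σ)),
      (∀ n x, W (n + 1) x ⊆ W n x) ∧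
      (∀ n x, {a | act (schemeProd γ n x : Γ) a ∈ W n x} ∈ r) ∧
      (∀ n x, ∃ A : Params 𝔐, A.Countable ∧ DefOver L A (W n x)) ∧
      (∀ n x y, ∀ g : Γ, schemeProd γ n y = g * schemeProd γ n x →
        ∀ a ∈ W n x, act g a ∈ W n y) ∧
      (∀ n x y, x n = false → y n = true → ∃ D D', DefOver L M.params D ∧
        DefOver L M.params D' ∧ W (n + 1) x ⊆ D ∧ W (n + 1) y ⊆ D' ∧
        ∀ a ∈ D, ∀ b ∈ D', ¬ Φ n a b) ∧
      ∀ D, DefOver L M.params D → ∃ n, ∀ x, W n x ⊆ D ∨ W n x ⊆ Dᶜ := by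
  classical
  have := hM.2.to_subtype
  have : Nonempty (FormulaOver L M.params σ) := ⟨.falsum⟩
  obtain ⟨enum, henum⟩ := exists_surjective_nat (FormulaOver L M.params σ)
  -- A state consists of the products formed so far and the current neighbourhood of `r`. Step `n`
  -- separates at distance `n` and decides the `n`-th formula over `M`.
  let St := {p : Finset Γ × Set (Tup 𝔐 σ) //
    p.2 ∈ r ∧ ∃ A : Params 𝔐, A.Countable ∧ DefOver L A p.2}
  choose γ' H' V hV hVU hγVU hH hsepV hdec using fun (p : St) (n : ℕ) =>
    exists_scheme_step hM hΓ p.2.1 p.2.2 (hsep p.1.1 n p.1.2 p.2.1)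
      (D₀ := {a | SatOver (enum n) a}) ⟨enum n, rfl⟩
  let st : ℕ → St := fun n => Nat.rec
    (⟨({1}, Set.univ), Filter.univ_mem, ∅, Set.countable_empty, DefOver.univ⟩ : St)
    (fun n p => ⟨(H' p n, V p n), hV p n⟩) n
  let γ : ℕ → Γ := fun n => γ' (st n) n
  let h : ℕ → (ℕ → Bool) → Γ := schemeProd γ
  have hmem : ∀ n x, h n x ∈ (st n).1.1 := by
    intro n x
    induction n with
    | zero => exact Finset.mem_singleton_self 1
    | succ n ih =>
      change h n x * (if x n then γ n else 1) ∈ H' (st n) n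
      cases x n
      · simpa using (hH (st n) n _ ih).1
      · exact (hH (st n) n _ ih).2
  let W : ℕ → (ℕ → Bool) → Set (Tup 𝔐 σ) := fun n x => {a | act (h n x)⁻¹.1 a ∈ (st n).1.2}
  have hWact : ∀ n x a, a ∈ W n x → ∃ b ∈ (st n).1.2, act (h n x) b = a := fun n x a ha =>
    ⟨_, ha, by rw [← act_mul, ← Subgroup.coe_mul, mul_inv_cancel]; rfl⟩
  have hactW : ∀ n x, ∀ g : Γ, ∀ b ∈ (st n).1.2, h n x = g → act g b ∈ W n x := by
    rintro n x g b hb rfl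
    change act (h n x)⁻¹.1 (act (h n x) b) ∈ (st n).1.2
    rwa [Subgroup.coe_inv, act_inv_act]
  refine ⟨γ, W, ?_, ?_, ?_, ?_, ?_, ?_⟩
  · intro n x a ha
    obtain ⟨b, hb, rfl⟩ := hWact (n + 1) x _ ha
    cases hx : x n with
    | false =>
      refine hactW n x _ b (hVU (st n) n hb) ?_
      simp [h, schemeProd, hx]
    | true =>
      have hh : h (n + 1) x = h n x * γ n := by simp [h, schemeProd, hx]
      rw [hh, Subgroup.coe_mul, act_mul]
      -- The new factor acts first, so nesting only needs `γ n` to send the new neighbourhood into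
      -- the old one.
      exact hactW n x _ _ (hγVU (st n) n b hb) rfl
  · exact fun n x => Filter.mem_of_superset (st n).2.1 fun b hb => hactW n x _ b hb rfl
  · intro n x
    obtain ⟨A, hA, hdef⟩ := (st n).2.2
    exact ⟨_, hA.image _, hdef.preimage_act (hΓ (h n x)⁻¹.2)⟩
  · intro n x y g hg a ha
    obtain ⟨b, hb, rfl⟩ := hWact n x _ ha
    rw [← act_mul, ← Subgroup.coe_mul]
    exact hactW n y _ b hb hg
  · intro n x y hx hy
    obtain ⟨D, D', hD, hD', hVD, hR⟩ := hsepV (st n) n _ (hmem n x) _ (hmem n y)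
    refine ⟨D, D', hD, hD', fun a ha => ?_, fun a ha => ?_, hR⟩
    · obtain ⟨b, hb, rfl⟩ := hWact (n + 1) x _ ha
      have hh : h (n + 1) x = h n x := by simp [h, schemeProd, hx]
      rw [hh]
      exact (hVD b hb).1
    · obtain ⟨b, hb, rfl⟩ := hWact (n + 1) y _ ha
      have hh : h (n + 1) y = h n y * γ n := by simp [h, schemeProd, hy]
      rw [hh]
      exact (hVD b hb).2
  · rintro _ ⟨φ, rfl⟩
    obtain ⟨n, rfl⟩ := henum φ
    refine ⟨n + 1, fun x => ?_⟩
    rcases hdec (st n) n _ (hmem (n + 1) x) with hd | hd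
    · left
      intro a ha
      obtain ⟨b, hb, rfl⟩ := hWact (n + 1) x _ ha
      exact hd b hb
    · right
      intro a ha
      obtain ⟨b, hb, rfl⟩ := hWact (n + 1) x _ ha
      exact hd b hb

end Embedding

/-! ### The unbounded class, realisation of branches, and the embedding. -/

section Main

variable {S : Type} {L : Lang S} {𝔐 : S → Type u} [Str L 𝔐] {κ : Cardinal.{u}}
  {I : Type} {σ : I → S} {X : Set (Tup 𝔐 σ)} {E : Tup 𝔐 σ → Tup 𝔐 σ → Prop}
  {Φ : ℕ → Tup 𝔐 σ → Tup 𝔐 σ → Prop}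

/-- In a relation which is orbital on types, the class of `a` is the orbit of `a` under a group of
automorphisms which preserves all classes of elements with the type of `a`. -/
theorem IsOrbitalOnTypes.exists_subgroup (h : IsOrbitalOnTypes L E X) (hE : IsEquivOn E X)
    (a₀ : Tup 𝔐 σ) : ∃ Γ : Subgroup (∀ s, Equiv.Perm (𝔐 s)), Γ ≤ Aut L 𝔐 ∧
      ∀ a ∈ X, tp L ∅ a = tp L ∅ a₀ → (∀ g ∈ Γ, E a (act g a)) ∧
        ∀ b, E a b → ∃ g ∈ Γ, act g a = b := by
  obtain ⟨htp, horb⟩ := h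
  obtain ⟨Γ, hΓ, hcl⟩ := horb (TypeSpace.of L ∅ a₀)
  refine ⟨Γ, hΓ, fun a ha hta => ?_⟩
  have hmem : ∀ b, E a b → restrict E {a | tp L ∅ a = tp L ∅ a₀} a b := fun b hb =>
    ⟨hb, hta, (htp a b hb).symm.trans hta⟩
  obtain ⟨hpres, htrans⟩ := hcl _ ⟨a, ⟨ha, hta⟩, rfl⟩
  refine ⟨fun g hg => ?_, fun b hb => htrans a (hmem a (hE.refl ha)) b (hmem b hb)⟩
  have h1 := (hpres g hg).subset ⟨a, hmem a (hE.refl ha), rfl⟩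
  exact h1.1

/-- If one class has infinite diameter, then so have all classes of elements of the same type. -/
theorem IsNormalForm.exists_not_rel_act (hΦ : IsNormalForm L Φ E X) (h𝔐 : IsMonster L 𝔐 κ)
    (hκ : Cardinal.aleph0 < κ) [Countable I] (hE : IsEquivOn E X) {a₀ a : Tup 𝔐 σ}
    (ha₀ : a₀ ∈ X) (hdiam : diameter Φ {b | E a₀ b} = ⊤) (ha : a ∈ X)
    (hta : tp L ∅ a = tp L ∅ a₀) {Γ : Subgroup (∀ s, Equiv.Perm (𝔐 s))}
    (htrans : ∀ b, E a b → ∃ g ∈ Γ, act g a = b) (N : ℕ) : ∃ g ∈ Γ, ¬ Φ N a (act g a) := by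
  by_contra hcon
  push Not at hcon
  have hA : Cardinal.mk (∅ : Params 𝔐) < κ := mk_lt_of_countable hκ Set.countable_empty
  obtain ⟨j, hj, -, rfl⟩ := h𝔐.homogeneous.exists_act_eq hκ hA hta.symm
  -- The bound on the orbit of `act j a₀` is carried back by the automorphism `j`; it makes the
  -- class of `a₀` a ball of radius `N`, of diameter at most `N + N`.
  have hbd : ∀ b, E a₀ b → Φ N a₀ b := by
    intro b hb
    obtain ⟨m, hm⟩ := (hΦ.equiv a₀ ha₀ b (hE.mem hb).2).1 hb
    obtain ⟨g, hg, hgb⟩ := htrans _ (hΦ.rel ((hΦ.act_iff hj).2 hm))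
    exact (hΦ.act_iff hj).1 (hgb ▸ hcon g hg)
  have hle : diameter Φ {b | E a₀ b} ≤ ((N + N : ℕ) : ℕ∞) :=
    iSup₂_le fun b hb => iSup₂_le fun c hc =>
      hΦ.dist_le_iff.2 (hΦ.trans (hΦ.symm (hbd b hb)) (hbd c hc))
  rw [hdiam] at hle
  exact absurd hle (by simp only [top_le_iff]; exact ENat.natCast_ne_top _)

/-- A point in the intersection of a decreasing sequence of countably definable sets which all meet
a subset of a pseudo-closed set can be found in the latter. -/
theorem IsSaturated.exists_mem_iInter (hsat : IsSaturated L 𝔐 κ) (hκ : Cardinal.aleph0 < κ)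
    [Countable I] {W : ℕ → Set (Tup 𝔐 σ)} (hW : Antitone W)
    (hdef : ∀ n, ∃ A : Params 𝔐, A.Countable ∧ DefOver L A (W n)) {C Y : Set (Tup 𝔐 σ)}
    (hCW : ∀ n, (C ∩ W n).Nonempty) (hY : IsPseudoClosed L κ Y) (hCY : C ⊆ Y) :
    ∃ a ∈ Y, (∀ n, a ∈ W n) ∧ ∀ D, DefOver L ∅ D → C ⊆ D → a ∈ D := by
  obtain ⟨B, hB, hYB⟩ := hY
  obtain ⟨𝓓, h𝓓, rfl⟩ := hYB.exists_family
  choose A hA hWA using hdef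
  -- The realised point may leave `C`, but it satisfies every small-parameter condition that `C`
  -- satisfies: membership in `Y` and the type over `∅`.
  let 𝓕 : Filter (Tup 𝔐 σ) := ⨅ n, Filter.principal (C ∩ W n)
  have h𝓕 : 𝓕.NeBot := by
    refine Filter.iInf_neBot_of_directed' ?_ fun n => Filter.principal_neBot_iff.2 (hCW n)
    refine (Antitone.directed_ge fun n m hnm => ?_)
    exact Filter.principal_mono.2 (Set.inter_subset_inter_right _ (hW hnm))
  have hmem : ∀ n, C ∩ W n ∈ 𝓕 := fun n =>
    Filter.mem_iInf_of_mem n (Filter.mem_principal_self _)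
  obtain ⟨a, ha⟩ := hsat.exists_mem_of_filter (L := L) hκ.le 𝓕 (A := B ∪ ⋃ n, A n)
    (mk_union_lt hκ.le hB (mk_lt_of_countable hκ (Set.countable_iUnion hA)))
  refine ⟨a, fun D hD => ?_, fun n => ?_, fun D hD hCD => ?_⟩
  · exact ha D (Filter.mem_of_superset (hmem 0) fun c hc => hCY hc.1 D hD)
      ((h𝓓 D hD).mono Set.subset_union_left)
  · exact ha _ (Filter.mem_of_superset (hmem n) Set.inter_subset_right)
      ((hWA n).mono ((Set.subset_iUnion A n).trans Set.subset_union_right))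
  · exact ha _ (Filter.mem_of_superset (hmem 0) fun c hc => hCD hc.1)
      (hD.mono (Set.empty_subset _))

/-- A relation to which eventual equality of binary sequences embeds continuously is not smooth. -/
theorem not_isSmooth_of_embedding {T : Type u} [TopologicalSpace T] {R : T → T → Prop}
    {f : (ℕ → Bool) → T} (hf : Continuous f) (hR : ∀ x y, E₀ x y ↔ R (f x) (f y)) :
    ¬ IsSmooth R := by
  rintro ⟨Z, hZ, hpol, g, hg, hgR⟩
  refine not_isSmooth_E₀ ⟨Z, hZ, hpol, g ∘ f, ?_, fun x y => (hR x y).trans (hgR _ _)⟩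
  let _ : MeasurableSpace T := borel T
  have : BorelSpace T := ⟨rfl⟩
  let _ : MeasurableSpace (ℕ → Bool) := borel _
  have : BorelSpace (ℕ → Bool) := ⟨rfl⟩
  exact hg.comp hf.measurable

/-- Eventual equality embeds into a bounded relation which is orbital on types and has a class of
infinite diameter. -/
theorem exists_embedding [Countable S] [Countable L.Fun] [Countable L.Rel] [Countable I]
    (h𝔐 : IsMonster L 𝔐 κ) (hκ : Cardinal.aleph0 < κ) (hX : IsTypeDefinableOver L ∅ X)
    (hE : IsEquivOn E X) (hE_bounded : Cardinal.mk (classes E X) < κ)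
    (hE_orbital : IsOrbitalOnTypes L E X) {Y : Set (Tup 𝔐 σ)} (hY : IsPseudoClosed L κ Y)
    {a₀ : Tup 𝔐 σ} (ha₀ : a₀ ∈ X) (hCY : {b | E a₀ b} ⊆ Y) (hΦ : IsNormalForm L Φ E X)
    (hdiam : diameter Φ {b | E a₀ b} = ⊤) {M : Substr L 𝔐} (hM : M.IsCountableModel) :
    ∃ f : (ℕ → Bool) → typesOf L M.params Y, Continuous f ∧ Function.Injective f ∧
      ∀ x y, E₀ x y ↔ inducedRelOn L M.params E Y (f x) (f y) := by
  obtain ⟨Γ, hΓ, hΓ'⟩ := hE_orbital.exists_subgroup hE a₀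
  let C : Set (Tup 𝔐 σ) := {b | E a₀ b}
  -- Limits of points of `C` need not lie in `C`, but they lie in `Z`, where `Γ` still preserves
  -- classes and all orbits are still unbounded.
  let Z : Set (Tup 𝔐 σ) := {a | a ∈ X ∧ tp L ∅ a = tp L ∅ a₀}
  have hCZ : C ⊆ Z := fun b hb => ⟨(hE.mem hb).2, (hE_orbital.1 a₀ b hb).symm⟩
  have hZ : ∀ c, (∀ D, DefOver L ∅ D → C ⊆ D → c ∈ D) → c ∈ Z := by
    intro c hc
    have htp : tp L ∅ a₀ = tp L ∅ c := tp_eq_of_forall_imp fun D hD ha₀D =>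
      hc D hD fun b hb => (tp_eq_iff.1 (hCZ hb).2 D hD).2 ha₀D
    exact ⟨hX.mem_of_tp_eq htp ha₀, htp.symm⟩
  have hΓC : ∀ g : Γ, Set.MapsTo (act (g : ∀ s, Equiv.Perm (𝔐 s))) C C := fun g b hb =>
    hE.trans hb ((hΓ' b (hCZ hb).1 (hCZ hb).2).1 g g.2)
  obtain ⟨r, hCr, hr⟩ := exists_almostPeriodic
    (fun (g : Γ) (a : Tup 𝔐 σ) => act (g : ∀ s, Equiv.Perm (𝔐 s)) a) (fun _ => rfl)
    (fun _ _ _ => rfl) (C := C) ⟨a₀, hE.refl ha₀⟩ hΓC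
  obtain ⟨γ, W, hWsucc, hWr, hWdef, hWact, hWsep, hWdec⟩ := exists_scheme (Φ := Φ) hM hΓ
    fun H N U hU => exists_separating h𝔐 hκ hΦ hM
      (fun a ha => hΦ.exists_forall_tp_eq h𝔐 hκ hX hE hE_bounded hM ha) hΓ (Z := Z)
      (fun a ha => ha.1) (fun a ha => (hΓ' a ha.1 ha.2).1)
      (fun a ha => hΦ.exists_not_rel_act h𝔐 hκ hE ha₀ hdiam ha.1 ha.2 (hΓ' a ha.1 ha.2).2)
      (fun A c hc => hZ c fun D hD hCD =>
        (hc D (hD.mono (Set.empty_subset _))).2 (Filter.mem_of_superset hCr hCD)) hr H N hU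
  have hWanti : ∀ x, Antitone fun n => W n x := fun x => antitone_nat_of_succ_le fun n => hWsucc n x
  have hCW : ∀ n x, (C ∩ W n x).Nonempty := by
    intro n x
    obtain ⟨b, hbW, hbC⟩ := Ultrafilter.nonempty_of_mem (Filter.inter_mem (hWr n x) hCr)
    exact ⟨_, hΓC _ hbC, hbW⟩
  choose a haY haW haC using fun x => h𝔐.saturated.exists_mem_iInter hκ (hWanti x)
    (fun n => hWdef n x) (fun n => hCW n x) hY hCY
  have haZ : ∀ x, a x ∈ Z := fun x => hZ _ (haC x)
  have htpW : ∀ x b, (∀ n, b ∈ W n x) → tp L M.params b = tp L M.params (a x) := by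
    intro x b hb
    refine tp_eq_of_forall_imp fun D hD hbD => ?_
    obtain ⟨n, hn⟩ := hWdec D hD
    rcases hn x with h | h
    · exact h (haW x n)
    · exact (h (hb n) hbD).elim
  have hsep : ∀ n x y, x n ≠ y n → ∀ b b', tp L M.params b = tp L M.params (a x) →
      tp L M.params b' = tp L M.params (a y) → ¬ Φ n b b' := by
    have key : ∀ n x y, x n = false → y n = true → ∀ b b', tp L M.params b = tp L M.params (a x) →
        tp L M.params b' = tp L M.params (a y) → ¬ Φ n b b' := by
      intro n x y hx hy b b' hb hb'
      obtain ⟨D, D', hD, hD', hxD, hyD', hR⟩ := hWsep n x y hx hy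
      exact hR b ((tp_eq_iff.1 hb D hD).2 (hxD (haW x _))) b'
        ((tp_eq_iff.1 hb' D' hD').2 (hyD' (haW y _)))
    intro n x y hxy b b' hb hb' hbb'
    cases hx : x n <;> cases hy : y n
    · exact hxy (hx.trans hy.symm)
    · exact key n x y hx hy b b' hb hb' hbb'
    · exact key n y x hy hx b' b hb' hb (hΦ.symm hbb')
    · exact hxy (hx.trans hy.symm)
  refine ⟨fun x => ⟨TypeSpace.of L M.params (a x), a x, haY x, rfl⟩, ?_, ?_, fun x y => ⟨?_, ?_⟩⟩
  · refine Continuous.subtype_mk (continuous_generateFrom_iff.2 ?_) _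
    rintro _ ⟨φ, rfl⟩
    -- The level `n` at which `φ` is decided gives the modulus of continuity: `W n x` depends only
    -- on `x` below `n`.
    obtain ⟨n, hn⟩ := hWdec {a | SatOver φ a} ⟨φ, rfl⟩
    rw [isOpen_iff_mem_nhds]
    intro x hx
    have hnhds : {y : ℕ → Bool | ∀ i ∈ Set.Iio n, y i = x i} ∈ nhds x := by
      have : {y : ℕ → Bool | ∀ i ∈ Set.Iio n, y i = x i} =
          (Set.Iio n).pi fun i => {x i} := rfl
      rw [this]
      exact set_pi_mem_nhds (Set.finite_Iio n) fun i _ => (isOpen_discrete _).mem_nhds rfl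
    refine Filter.mem_of_superset hnhds fun y hy => ?_
    have hyx : schemeProd γ n x = 1 * schemeProd γ n y := by
      rw [one_mul]
      exact schemeProd_congr γ fun i hi => (hy i hi).symm
    have hay : a y ∈ W n x := hWact n y x 1 hyx _ (haW y n)
    rcases hn x with h | h
    · exact h hay
    · exact (h (haW x n) hx).elim
  · intro x y hxy
    by_contra hne
    obtain ⟨n, hn⟩ := Function.ne_iff.1 hne
    have htp : tp L M.params (a x) = tp L M.params (a y) :=
      congrArg (fun p => p.1.1) hxy
    exact hsep n x y hn (a x) (a x) rfl htp (hΦ.refl n (haZ x).1)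
  · rintro ⟨N, hN⟩
    let g : Γ := schemeProd γ N y * (schemeProd γ N x)⁻¹
    refine ⟨a x, act g (a x), rfl, ?_, (hΓ' _ (haZ x).1 (haZ x).2).1 g g.2⟩
    refine Subtype.ext (htpW y _ fun n => ?_)
    -- Translation by `g` matches the two branches only from level `N` on; lower levels follow by
    -- monotonicity.
    exact hWanti y (le_max_left n N) (hWact _ x y g
      (schemeProd_mul_inv γ hN (le_max_right n N)) _ (haW x _))
  · rintro ⟨b, b', hb, hb', hbb'⟩
    by_contra hxy
    obtain ⟨N, hN⟩ := (hΦ.equiv b (hE.mem hbb').1 b' (hE.mem hbb').2).1 hbb'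
    -- The distance `N` is beaten by a difference of `x` and `y` at some place beyond `N`. The
    -- separation concerns types over `M`, so it applies to the arbitrary realisations `b` and `b'`.
    have hex : ∃ n ≥ N, x n ≠ y n := by
      by_contra hcon
      push Not at hcon
      exact hxy ⟨N, hcon⟩
    obtain ⟨n, hn, hne⟩ := hex
    exact hsep n x y hne b b' (congrArg Subtype.val hb) (congrArg Subtype.val hb')
      (hΦ.monotone hn hN)

end Main

end ManySorted

theorem theorem3p3
    {S : Type} [Countable S] (L : ManySorted.Lang S) [Countable L.Fun] [Countable L.Rel]
    (𝔐 : S → Type u) [ManySorted.Str L 𝔐]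
    (κ : Cardinal.{u}) (hκ : Cardinal.continuum < κ) (h𝔐 : ManySorted.IsMonster L 𝔐 κ)
    {I : Type} [Countable I] (σ : I → S)
    (X : Set (ManySorted.Tup 𝔐 σ)) (hX : ManySorted.IsTypeDefinableOver L ∅ X)
    (E : ManySorted.Tup 𝔐 σ → ManySorted.Tup 𝔐 σ → Prop)
    (hE : ManySorted.IsEquivOn E X)
    (hE_bounded : Cardinal.mk (ManySorted.classes E X) < κ)
    (hE_fsigma : ManySorted.IsFSigma L E)
    (hE_orbital : ManySorted.IsOrbitalOnTypes L E X)
    (Y : Set (ManySorted.Tup 𝔐 σ)) (hYX : Y ⊆ X)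
    (hY_closed : ManySorted.IsPseudoClosed L κ Y) (hY_sat : ManySorted.IsSaturatedFor E Y)
    (C : Set (ManySorted.Tup 𝔐 σ)) (hC : C ∈ ManySorted.classes E X) (hCY : C ⊆ Y)
    (hC_diam : ∃ Φ : ℕ → ManySorted.Tup 𝔐 σ → ManySorted.Tup 𝔐 σ → Prop,
      ManySorted.IsNormalForm L Φ E X ∧ ManySorted.diameter Φ C = ⊤) :
    ¬ ManySorted.IsSmoothOn L E Y ∧
    ∀ M : ManySorted.Substr L 𝔐, M.IsCountableModel →
      ∃ f : (ℕ → Bool) → ManySorted.typesOf L M.params Y,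
        Continuous f ∧ Function.Injective f ∧
        ∀ x y, ManySorted.E₀ x y ↔ ManySorted.inducedRelOn L M.params E Y (f x) (f y) := by
  obtain ⟨a₀, ha₀, rfl⟩ := hC
  obtain ⟨Φ, hΦ, hdiam⟩ := hC_diam
  have hκ' : Cardinal.aleph0 < κ := Cardinal.aleph0_lt_continuum.trans hκ
  have hemb := fun (M : ManySorted.Substr L 𝔐) (hM : M.IsCountableModel) =>
    ManySorted.exists_embedding h𝔐 hκ' hX hE hE_bounded hE_orbital hY_closed ha₀ hCY hΦ hdiam hM
  refine ⟨?_, hemb⟩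
  rintro ⟨M, hM, hsmooth⟩
  obtain ⟨f, hf, -, hfE⟩ := hemb M hM
  exact ManySorted.not_isSmooth_of_embedding hf hfE hsmooth
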